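/- **Setting.** An adversarial team Markov game $\mathcal G$ has a finite nonempty state space $\mathcal S$ ($S=|\mathcal S|$), $n$ team players with finite nonempty action sets $\mathcal A_k$ ($A_k=|\mathcal A_k|$), an adversary with a finite nonempty action set $\mathcal B$ ($B=|\mathcal B|$), a reward $r:\mathcal S\times\prod_k\mathcal A_k\times\mathcal B\to(0,1)$ of the adversary, one common reward $r_{\rm team}$ for all team players with $r+n\,r_{\rm team}=0$, transition probabilities $\mathbb P(\cdot\mid s,\boldsymbol a,b)\in\Delta(\mathcal S)$, a discount factor $\gamma\in[0,1)$ and an initial distribution $\rho\in\Delta(\mathcal S)$ with full support. Put $\mathcal X_k=\Delta(\mathcal A_k)^{S}$, $\mathcal X=\prod_k\mathcal X_k$, $\mathcal Y=\Delta(\mathcal B)^{S}$. For $(x,y)\in\mathcal X\times\mathcal Y$ let $$V_s(x,y)=\mathbb E_{x,y}\Big[\sum_{t\ge0}\gamma^t r(s^{(t)},\boldsymbol a^{(t)},b^{(t)})\,\Big|\,s^{(0)}=s\Big],\qquad V_\rho(x,y)=\sum_s\rho(s)V_s(x,y),\qquad d_\rho^{x,y}(s)=\sum_{\bar s}\rho(\bar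 s)\sum_{t\ge0}\gamma^t\,\mathbb P^{x,y}(s^{(t)}=s\mid s^{(0)}=\bar s),$$ and put $\phi(x)=\max_{y\in\mathcal Y}V_\rho(x,y)$, $D=\sup_{(x,y)\in\mathcal X\times\mathcal Y}\max_s d_\rho^{x,y}(s)/\rho(s)$, $$L=\frac{\sqrt{\sum_kA_k+B}}{(1-\gamma)^2},\quad \ell=\frac{2(\sum_kA_k+B)}{(1-\gamma)^3},\quad c_2=\frac1{1-\gamma}\Big(\sqrt{\textstyle\sum_kA_k}+\frac{\gamma S\sqrt{\sum_kA_k}}{1-\gamma}+\gamma SL+L\Big),\quad c_1=4\ell+c_2 .$$ Write $r(s,x,b)$ and $\mathbb P(s'\mid s,x,b)$ for the expectations of $r(s,\boldsymbol a,b)$ and $\mathbb P(s'\mid s,\boldsymbol a,b)$ when every team player $k$ independently draws $a_k\sim x_{k,s}$, and $(e_{k,s,a};x_{-k})$ for the profile in which player $k$ plays $a$ in state $s$ with probability one while the others follow $x$. Let $\varepsilon>0$ and let $\hat x\in\mathcal X$ be an $\varepsilon$-nearly stationary point of $\phi$: $\|\hat x-\tilde x\|_2\le\varepsilon$ for the proximal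 point $\tilde x=\mathrm{prox}_{\phi/(2\ell)}(\hat x)$, i.e. $\tilde x$ minimizes $\frac1{2\ell}\phi(x')+\frac12\|x'-\hat x\|_2^2$ over $x'\in\mathcal X$. Let $\hat v(s)=\max_{y\in\mathcal Y}V_s(\hat x,y)$. The linear program $\mathrm{LP}_{\rm adv}$ has variables $\lambda(s,b)\ge0$, $(s,b)\in\mathcal S\times\mathcal B$, and constraints $$\sum_b\lambda(s,b)\Big[r(s,(e_{k,s,a};\hat x_{-k}),b)+\gamma\sum_{s'}\mathbb P(s'\mid s,(e_{k,s,a};\hat x_{-k}),b)\hat v(s')-\hat v(s)\Big]\ge-c_1\varepsilon\quad\forall k,s,\ a\in\mathcal A_k,$$ $$-c_2\varepsilon\le\lambda(s,b)\Big(r(s,\hat x,b)+\gamma\sum_{s'}\mathbb P(s'\mid s,\hat x,b)\hat v(s')-\hat v(s)\Big)\le c_2\varepsilon\quad\forall s,b,\qquad \rho(s)\le\sum_b\lambda(s,b)\le\frac1{1-\gamma}\quad\forall s.$$ **Theorem.** $\mathrm{LP}_{\rm adv}$ is feasible. Moreover, for every feasible $\lambda$, the formula $\hat y_{s,b}=\lambda(s,b)/\sum_{b'}\lambda(s,b')$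 defines a strategy $\hat y\in\mathcal Y$, and for every player $k$, every $x_k\in\mathcal X_k$ and every $y\in\mathcal Y$, $$V_\rho(\hat x,\hat y)\le V_\rho((x_k;\hat x_{-k}),\hat y)+\big(c_2\,BSD+c_1\,SD\big)\varepsilon,\qquad V_\rho(\hat x,\hat y)\ge V_\rho(\hat x,y)-c_2\,BSD\,\varepsilon .$$ In particular $(\hat x,\hat y)$ is a $\big(c_2BSD+c_1SD\big)\varepsilon$-approximate Nash equilibrium: no unilateral deviation of a team player decreases, and no deviation of the adversary increases, $V_\rho$ by more than that amount. -/

import Mathlib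

open MeasureTheory ProbabilityTheory
open scoped ENNReal

noncomputable section

/-- A point of the probability simplex, as a `PMF`. -/
def simplexPMF {ι : Type*} [Fintype ι] (p : stdSimplex ℝ ι) : PMF ι :=
  PMF.ofFintype (fun i => ENNReal.ofReal (p i)) (by
    have h : ∑ i, p i = 1 := p.2.2
    have h0 : ∀ i ∈ Finset.univ, 0 ≤ p i := fun i _ => p.2.1 i
    rw [← ENNReal.ofReal_sum_of_nonneg h0, h, ENNReal.ofReal_one])

/-- The product of finitely many `PMF`s on finite types. -/
def prodPMF {n : ℕ} {A : Fin n → Type*} [∀ k, Fintype (A k)] (p : ∀ k, PMF (A k)) :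
    PMF (∀ k, A k) :=
  PMF.ofFintype (fun a => ∏ k, p k (a k)) (by
    have h : ∀ k, ∑ a, p k a = 1 := fun k => by
      have := (p k).tsum_coe
      rwa [tsum_fintype] at this
    rw [← Fintype.prod_sum]
    simp [h])

/-- Adversarial team Markov games with `n` team players, state space `S`, team action spaces
`A k` and adversary action space `B`. All team players receive the same reward `rTeam`, and the
game is globally zero-sum. -/
structure AdvTeamGame {n : ℕ} (S : Type*) (A : Fin n → Type*) (B : Type*) [Fintype S] where
  /-- reward of the adversary -/
  r : S → (∀ k, A k) → B → ℝ
  r_pos : ∀ s a b, 0 < r s a b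
  r_lt_one : ∀ s a b, r s a b < 1
  /-- common reward of every team player -/
  rTeam : S → (∀ k, A k) → B → ℝ
  zero_sum : ∀ s a b, r s a b + ∑ _k : Fin n, rTeam s a b = 0
  /-- transition probabilities -/
  P : S → (∀ k, A k) → B → stdSimplex ℝ S
  /-- discount factor -/
  γ : ℝ
  γ_nonneg : 0 ≤ γ
  γ_lt_one : γ < 1
  /-- initial state distribution -/
  ρ : stdSimplex ℝ S
  ρ_pos : ∀ s, 0 < ρ s

/-- Directly parametrised stationary policies of the team: `x k s a` is the probability that
player `k` plays `a` in state `s`. -/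
abbrev TeamStrategy {n : ℕ} (S : Type*) (A : Fin n → Type*) [∀ k, Fintype (A k)] : Type _ :=
  ∀ k : Fin n, S → stdSimplex ℝ (A k)

/-- Directly parametrised stationary policies of the adversary. -/
abbrev AdvStrategy (S B : Type*) [Fintype B] : Type _ := S → stdSimplex ℝ B

/-- State, team actions and adversary action at one time step. -/
def Outcome {n : ℕ} (S : Type*) (A : Fin n → Type*) (B : Type*) : Type _ :=
  S × (∀ k, A k) × B

section Outcome

variable {n : ℕ} {S B : Type*} {A : Fin n → Type*}

def Outcome.state (z : Outcome S A B) : S := z.1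
def Outcome.team (z : Outcome S A B) : ∀ k, A k := z.2.1
def Outcome.adv (z : Outcome S A B) : B := z.2.2

instance : MeasurableSpace (Outcome S A B) := ⊤
instance : DiscreteMeasurableSpace (Outcome S A B) := ⟨fun _ => trivial⟩
instance [Finite S] [∀ k, Finite (A k)] [Finite B] : Finite (Outcome S A B) :=
  inferInstanceAs (Finite (S × (∀ k, A k) × B))

end Outcome

/-- The Euclidean distance between two team strategies, seen as vectors `(x k s a)`. -/
def l2dist {n : ℕ} {S : Type*} {A : Fin n → Type*} [Fintype S] [∀ k, Fintype (A k)]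
    (x x' : TeamStrategy S A) : ℝ :=
  Real.sqrt (∑ k, ∑ s, ∑ a, (x k s a - x' k s a) ^ 2)

/-- `xt` is a proximal point of `f` at `x`, that is, `xt` minimises `f z + ‖z - x‖² / 2` over all
team strategies `z`. -/
def IsProxPoint {n : ℕ} {S : Type*} {A : Fin n → Type*} [Fintype S] [∀ k, Fintype (A k)]
    (f : TeamStrategy S A → ℝ) (x xt : TeamStrategy S A) : Prop :=
  ∀ z : TeamStrategy S A, f xt + l2dist xt x ^ 2 / 2 ≤ f z + l2dist z x ^ 2 / 2

/-- `x` is `ε`-nearly stationary for `f` (with proximal parameter `μ`): it is within Euclidean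
distance `ε` of the proximal point of `μ f` at `x`. -/
def IsNearlyStationary {n : ℕ} {S : Type*} {A : Fin n → Type*} [Fintype S] [∀ k, Fintype (A k)]
    (f : TeamStrategy S A → ℝ) (μ ε : ℝ) (x : TeamStrategy S A) : Prop :=
  ∃ xt : TeamStrategy S A, IsProxPoint (fun z => μ * f z) x xt ∧ l2dist x xt ≤ ε

namespace AdvTeamGame

variable {n : ℕ} {S B : Type*} {A : Fin n → Type*} [Fintype S] [∀ k, Fintype (A k)] [Fintype B]
variable (G : AdvTeamGame S A B)

/-! ### Trajectories -/

/-- The law of `(s, a, b)` when the team players and the adversary draw their actions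
independently according to their policies in state `s`. -/
def outcomeLaw (x : TeamStrategy S A) (y : AdvStrategy S B) (s : S) : PMF (Outcome S A B) :=
  (prodPMF fun k => simplexPMF (x k s)).bind fun a =>
    (simplexPMF (y s)).map fun b => ((s, a, b) : S × (∀ k, A k) × B)

/-- The law of the next state and actions, given the current ones. -/
def nextLaw (x : TeamStrategy S A) (y : AdvStrategy S B) (z : Outcome S A B) :
    PMF (Outcome S A B) :=
  (simplexPMF (G.P z.state z.team z.adv)).bind (outcomeLaw x y)

/-- The one-step Markov kernel on outcomes. -/
def stepKernel (x : TeamStrategy S A) (y : AdvStrategy S B) :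
    Kernel (Outcome S A B) (Outcome S A B) :=
  Kernel.ofFunOfCountable fun z => (G.nextLaw x y z).toMeasure

instance (x : TeamStrategy S A) (y : AdvStrategy S B) : IsMarkovKernel (G.stepKernel x y) :=
  ⟨fun z => inferInstanceAs (IsProbabilityMeasure (G.nextLaw x y z).toMeasure)⟩

/-- The kernel giving the outcome at time `t + 1` from the history up to time `t`. -/
def historyKernel (x : TeamStrategy S A) (y : AdvStrategy S B) (t : ℕ) :
    Kernel (Finset.Iic t → Outcome S A B) (Outcome S A B) :=
  (G.stepKernel x y).comap (fun h => h ⟨t, Finset.mem_Iic.2 le_rfl⟩) (measurable_pi_apply _)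

instance (x : TeamStrategy S A) (y : AdvStrategy S B) (t : ℕ) :
    IsMarkovKernel (G.historyKernel x y t) :=
  inferInstanceAs (IsMarkovKernel (Kernel.comap _ _ _))

/-- The distribution of the infinite trajectory started in state `s` under `(x, y)`. -/
def trajLaw (x : TeamStrategy S A) (y : AdvStrategy S B) (s : S) :
    Measure (ℕ → Outcome S A B) :=
  Kernel.trajMeasure (X := fun _ => Outcome S A B) (outcomeLaw x y s).toMeasure
    (G.historyKernel x y)

/-! ### Value functions and equilibria -/

/-- `V_s(x, y)`: the expected cumulative discounted reward of the adversary. -/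
def V (x : TeamStrategy S A) (y : AdvStrategy S B) (s : S) : ℝ :=
  ∫ ω, ∑' t : ℕ, G.γ ^ t * G.r (ω t).state (ω t).team (ω t).adv ∂(G.trajLaw x y s)

/-- `V_ρ(x, y)`. -/
def Vrho (x : TeamStrategy S A) (y : AdvStrategy S B) : ℝ := ∑ s, G.ρ s * G.V x y s

/-- `φ(x) = max_y V_ρ(x, y)`. -/
def phi (x : TeamStrategy S A) : ℝ := ⨆ y : AdvStrategy S B, G.Vrho x y

/-- The best-response value vector of the adversary: `v(s) = max_y V_s(x, y)`. -/
def bestValue (x : TeamStrategy S A) (s : S) : ℝ := ⨆ y : AdvStrategy S B, G.V x y s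

/-- `(x, y)` is an `ε`-approximate Nash equilibrium: no unilateral deviation of a team player
decreases, and no deviation of the adversary increases, the value by more than `ε`. -/
def IsApproxNash (ε : ℝ) (x : TeamStrategy S A) (y : AdvStrategy S B) : Prop :=
  (∀ (k : Fin n) (xk : S → stdSimplex ℝ (A k)),
    G.Vrho x y ≤ G.Vrho (Function.update x k xk) y + ε) ∧
  ∀ y' : AdvStrategy S B, G.Vrho x y' - ε ≤ G.Vrho x y

/-! ### Visitation measure and mismatch coefficient -/

/-- The discounted state visitation measure, `d_ρ(s) = E_{s₀ ∼ ρ} ∑ₜ γᵗ Pr(sₜ = s | s₀)`. -/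
def visitation (x : TeamStrategy S A) (y : AdvStrategy S B) (s : S) : ℝ :=
  ∑ s₀, G.ρ s₀ * ∑' t : ℕ, G.γ ^ t * (G.trajLaw x y s₀).real {ω | (ω t).state = s}

/-- The distribution mismatch coefficient `D`, the supremum over all joint policies of
`‖d_ρ / ρ‖_∞` (the norm of `S → ℝ` is the sup norm). -/
def mismatch : ℝ :=
  sSup {c | ∃ (x : TeamStrategy S A) (y : AdvStrategy S B),
    c = ‖fun s => G.visitation x y s / G.ρ s‖}

/-! ### The constants -/

/-- `∑ₖ Aₖ`, the total number of actions of the team players. -/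
def sumA (_G : AdvTeamGame S A B) : ℝ := ∑ k, (Fintype.card (A k) : ℝ)

/-- `S`, the number of states. -/
def numS (_G : AdvTeamGame S A B) : ℝ := Fintype.card S

/-- `B`, the number of actions of the adversary. -/
def numB (_G : AdvTeamGame S A B) : ℝ := Fintype.card B

/-- `L`, a Lipschitz constant of the value function. -/
def L : ℝ := Real.sqrt (G.sumA + G.numB) / (1 - G.γ) ^ 2

/-- `ℓ`, a smoothness constant of the value function. -/
def ell : ℝ := 2 * (G.sumA + G.numB) / (1 - G.γ) ^ 3

/-- The slackness parameter `c₂`. -/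
def c₂ : ℝ :=
  1 / (1 - G.γ) * (Real.sqrt G.sumA + G.γ * G.numS * Real.sqrt G.sumA * (1 / (1 - G.γ))
    + G.γ * G.numS * G.L + G.L)

/-- The slackness parameter `c₁`. -/
def c₁ : ℝ := 4 * G.ell + G.c₂

/-! ### The linear program of the adversary -/

/-- `r(s, ξ, b)`: expected reward in state `s` when the team plays the mixed action profile `ξ`
(with `ξ k` a vector of probabilities over `A k`) and the adversary plays `b`. -/
def rMix (s : S) (ξ : ∀ k, A k → ℝ) (b : B) : ℝ := ∑ a, (∏ k, ξ k (a k)) * G.r s a b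

/-- `Pr(s' | s, ξ, b)`: expected transition probability under the mixed action profile `ξ`. -/
def PMix (s' s : S) (ξ : ∀ k, A k → ℝ) (b : B) : ℝ := ∑ a, (∏ k, ξ k (a k)) * G.P s a b s'

/-- `r(s, ξ, b) + γ ∑_{s'} Pr(s' | s, ξ, b) v(s') - v(s)`. -/
def bellmanGap (v : S → ℝ) (s : S) (ξ : ∀ k, A k → ℝ) (b : B) : ℝ :=
  G.rMix s ξ b + G.γ * ∑ s', G.PMix s' s ξ b * v s' - v s

/-- The mixed action profile of the team in state `s` under `x`. -/
def profile (x : TeamStrategy S A) (s : S) : ∀ k, A k → ℝ := fun k a => x k s a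

open Classical in
/-- The mixed action profile in state `s` under `(e_{k,s,a}; x_{-k})`, where player `k` plays `a`
with probability one. -/
def pureDeviation (x : TeamStrategy S A) (s : S) (k : Fin n) (a : A k) : ∀ k, A k → ℝ :=
  Function.update (profile x s) k (Pi.single a 1)

/-- The constraints of the linear program `LP_adv` in the variables `lam s b`, for the team
strategy `x` with its best-response value vector. -/
structure LPadvFeasible (x : TeamStrategy S A) (ε : ℝ) (lam : S → B → ℝ) : Prop where
  nonneg : ∀ s b, 0 ≤ lam s b
  team_stationary : ∀ (k : Fin n) (s : S) (a : A k),
    -(G.c₁ * ε) ≤ ∑ b, lam s b * G.bellmanGap (G.bestValue x) s (pureDeviation x s k a) b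
  slack_le : ∀ s b, lam s b * G.bellmanGap (G.bestValue x) s (profile x s) b ≤ G.c₂ * ε
  le_slack : ∀ s b, -(G.c₂ * ε) ≤ lam s b * G.bellmanGap (G.bestValue x) s (profile x s) b
  rho_le : ∀ s, G.ρ s ≤ ∑ b, lam s b
  sum_le : ∀ s, ∑ b, lam s b ≤ 1 / (1 - G.γ)

end AdvTeamGame

end

set_option linter.unusedSectionVars false

noncomputable section

/-! ### Expectations over finite types -/

/-! For a fixed team strategy `x` the adversary faces a finite discounted decision process with
optimal value `v = bestValue x`, and `phi x = ∑ s, ρ s * v s`. Everything is expressed through the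
Bellman gap of a value vector. By the performance difference identity `Vrho_sub_eq`, `Vrho x y - ∑
s, ρ s * v s` is the visitation-weighted average of the gaps of any vector `v`; in particular, a
vector with nonpositive gaps dominates every value (`V_le_of_bellmanGap_nonpos`).

Feasible points give equilibria: apply this identity with `v = bestValue xhat`, once at `(xhat,
yhat)` and once after a deviation of player `k`. Normalising `lam` divides the slacks by at least `ρ
s`, the visitation measure is at most `D * ρ s`, and summing over states gives the factor `S * D`.
The gap is affine in player `k`'s own mixed action, so constraints for pure deviations suffice.

Feasibility: the proximal point `xt` minimises `phi + ℓ ‖· - xhat‖²`. The multipliers at `xt` are a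
mixture, over the deterministic best responses of the adversary, of their state-action occupancy
measures; this gives complementary slackness and both mass bounds at once. Ville's alternative
either supplies a mixture meeting all stationarity inequalities, or a single feasible direction
along which every optimal deterministic response has negative derivative. In the second case,
solving the optimality equation restricted to tight actions yields a vector `w` such that `v + t (w
+ η)` has nonpositive gaps along the direction for small `t > 0`, so the objective decreases, a
contradiction (`exists_linearized_value_nonneg`, `exists_multipliers`). No smoothness of `phi` is
needed. The same multipliers are then used at `xhat`; Lipschitz bounds on the gaps and on the
best-response value cost `c₂ ε`, and the gradient of the proximal term costs `4 ℓ ε`. -/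

/-- The expectation of a real function under a `PMF` on a finite type. -/
def PMF.finExp {α : Type*} [Fintype α] (p : PMF α) (f : α → ℝ) : ℝ := ∑ a, (p a).toReal * f a

theorem PMF.finExp_bind {α β : Type*} [Fintype α] [Fintype β] (p : PMF α) (q : α → PMF β)
    (f : β → ℝ) : (p.bind q).finExp f = p.finExp fun a => (q a).finExp f := by
  have h : ∀ b, ((p.bind q) b).toReal = ∑ a, (p a).toReal * (q a b).toReal := fun b => by
    rw [PMF.bind_apply, tsum_fintype, ENNReal.toReal_sum]
    · simp
    · exact fun a _ => ENNReal.mul_ne_top (p.apply_ne_top a) ((q a).apply_ne_top b)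
  simp only [PMF.finExp, h, Finset.sum_mul, Finset.mul_sum]
  rw [Finset.sum_comm]
  simp only [mul_assoc]

theorem PMF.finExp_pure {α : Type*} [Fintype α] (a : α) (f : α → ℝ) :
    (PMF.pure a).finExp f = f a := by
  classical
  rw [PMF.finExp, Finset.sum_eq_single a]
  · simp
  · intro b _ hb
    simp [PMF.pure_apply, hb]
  · simp

theorem PMF.finExp_map {α β : Type*} [Fintype α] [Fintype β] (p : PMF α) (g : α → β)
    (f : β → ℝ) : (p.map g).finExp f = p.finExp fun a => f (g a) := by
  rw [← PMF.bind_pure_comp, PMF.finExp_bind]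
  simp [PMF.finExp_pure]

theorem simplexPMF_finExp {ι : Type*} [Fintype ι] (p : stdSimplex ℝ ι) (f : ι → ℝ) :
    (simplexPMF p).finExp f = ∑ i, p i * f i := by
  refine Finset.sum_congr rfl fun i _ => ?_
  simp only [simplexPMF, PMF.ofFintype_apply]
  congr 1
  exact ENNReal.toReal_ofReal (p.2.1 i)

theorem prodPMF_simplexPMF_finExp {n : ℕ} {A : Fin n → Type*} [∀ k, Fintype (A k)]
    (p : ∀ k, stdSimplex ℝ (A k)) (f : (∀ k, A k) → ℝ) :
    (prodPMF fun k => simplexPMF (p k)).finExp f = ∑ a, (∏ k, p k (a k)) * f a := by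
  refine Finset.sum_congr rfl fun a _ => ?_
  simp only [prodPMF, simplexPMF, PMF.ofFintype_apply]
  rw [ENNReal.toReal_prod]
  congr 1
  exact Finset.prod_congr rfl fun k _ => ENNReal.toReal_ofReal ((p k).2.1 _)

instance {n : ℕ} {S B : Type*} {A : Fin n → Type*} [Fintype S] [∀ k, Fintype (A k)] [Fintype B] :
    Fintype (Outcome S A B) :=
  inferInstanceAs (Fintype (S × (∀ k, A k) × B))

theorem PMF.integral_eq_finExp {n : ℕ} {S B : Type*} {A : Fin n → Type*} [Fintype S]
    [∀ k, Fintype (A k)] [Fintype B] (p : PMF (Outcome S A B)) (f : Outcome S A B → ℝ) :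
    ∫ z, f z ∂p.toMeasure = p.finExp f := by
  rw [PMF.integral_eq_sum]
  rfl

namespace AdvTeamGame

variable {n : ℕ} {S B : Type*} {A : Fin n → Type*} [Fintype S] [∀ k, Fintype (A k)] [Fintype B]
variable (G : AdvTeamGame S A B)

/-! ### The law of the trajectory at a fixed time -/

/-- The expected value of `h` on the outcome in state `s` under `(x, y)`. -/
def stateExp (x : TeamStrategy S A) (y : AdvStrategy S B) (h : S → (∀ k, A k) → B → ℝ) (s : S) :
    ℝ :=
  ∑ b, y s b * ∑ a, (∏ k, profile x s k (a k)) * h s a b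

/-- The state transition matrix under `(x, y)`. -/
def transMat (x : TeamStrategy S A) (y : AdvStrategy S B) : Matrix S S ℝ :=
  fun s s' => ∑ b, y s b * G.PMix s' s (profile x s) b

theorem finExp_outcomeLaw (x : TeamStrategy S A) (y : AdvStrategy S B) (s : S)
    (h : S → (∀ k, A k) → B → ℝ) :
    (outcomeLaw x y s).finExp (fun z => h z.state z.team z.adv) = stateExp x y h s := by
  refine (PMF.finExp_bind (β := Outcome S A B) _ _ _).trans ?_
  rw [prodPMF_simplexPMF_finExp]
  refine (Finset.sum_congr rfl fun a _ => congrArg (_ * ·)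
    ((PMF.finExp_map (β := Outcome S A B) _ _ _).trans (simplexPMF_finExp _ _))).trans ?_
  simp only [stateExp, Finset.mul_sum]
  rw [Finset.sum_comm]
  refine Finset.sum_congr rfl fun b _ => Finset.sum_congr rfl fun a _ => ?_
  simp only [profile, Outcome.state, Outcome.team, Outcome.adv]
  ring

theorem transMat_mulVec (x : TeamStrategy S A) (y : AdvStrategy S B) (v : S → ℝ) :
    (G.transMat x y).mulVec v = stateExp x y fun s a b => ∑ s', G.P s a b s' * v s' := by
  ext s
  simp only [Matrix.mulVec, dotProduct, transMat, stateExp, PMix, Finset.sum_mul, Finset.mul_sum]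
  rw [Finset.sum_comm]
  refine Finset.sum_congr rfl fun b _ => ?_
  rw [Finset.sum_comm]
  refine Finset.sum_congr rfl fun a _ => Finset.sum_congr rfl fun s' _ => ?_
  ring

instance (x : TeamStrategy S A) (y : AdvStrategy S B) (s : S) :
    IsProbabilityMeasure (G.trajLaw x y s) :=
  inferInstanceAs (IsProbabilityMeasure (Kernel.trajMeasure _ _))

theorem map_trajLaw_zero (x : TeamStrategy S A) (y : AdvStrategy S B) (s : S) :
    (G.trajLaw x y s).map (fun ω => ω 0) = (outcomeLaw x y s).toMeasure := by
  have h : (G.trajLaw x y s).map (Preorder.frestrictLe 0)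
      = (outcomeLaw x y s).toMeasure.map (MeasurableEquiv.piUnique _).symm := by
    rw [trajLaw, Kernel.trajMeasure, Measure.map_comp _ _ (by fun_prop),
      Kernel.traj_map_frestrictLe, Kernel.partialTraj_self, Measure.id_comp]
  have h0 : Measurable fun u : Finset.Iic 0 → Outcome S A B => u ⟨0, Finset.mem_Iic.2 le_rfl⟩ :=
    measurable_pi_apply _
  have h1 := congrArg (Measure.map fun u => u ⟨0, Finset.mem_Iic.2 le_rfl⟩) h
  rw [Measure.map_map h0 (by fun_prop), Measure.map_map h0 (by fun_prop)] at h1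
  exact h1.trans Measure.map_id

/-- The joint law of the history up to `t` and the next outcome is the history law composed with the
kernel, and that kernel depends only on the last outcome. -/
theorem integral_trajLaw_succ (x : TeamStrategy S A) (y : AdvStrategy S B) (s : S) (t : ℕ)
    (h : Outcome S A B → ℝ) :
    ∫ ω, h (ω (t + 1)) ∂G.trajLaw x y s
      = ∫ ω, (G.nextLaw x y (ω t)).finExp h ∂G.trajLaw x y s := by
  have hm := Kernel.map_frestrictLe_trajMeasure_compProd_eq_map_trajMeasure
    (X := fun _ => Outcome S A B) (μ₀ := (outcomeLaw x y s).toMeasure)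
    (κ := G.historyKernel x y) (a := t)
  have hh : Measurable h := measurable_from_top
  change (G.trajLaw x y s).map _ ⊗ₘ _ = (G.trajLaw x y s).map _ at hm
  have h1 := integral_map (μ := G.trajLaw x y s)
    (φ := fun ω : ℕ → Outcome S A B => (Preorder.frestrictLe t ω, ω (t + 1)))
    (by fun_prop) (f := fun p : (Finset.Iic t → Outcome S A B) × Outcome S A B => h p.2)
    (hh.comp measurable_snd).aestronglyMeasurable
  rw [← hm, Measure.integral_compProd, integral_map (by fun_prop)] at h1
  · rw [← h1]
    refine integral_congr_ae (Filter.Eventually.of_forall fun ω => ?_)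
    simp only [historyKernel, Kernel.comap_apply]
    exact PMF.integral_eq_finExp (G.nextLaw x y (ω t)) h
  · exact (Measurable.stronglyMeasurable (by
      simp only [historyKernel, Kernel.comap_apply]
      exact (measurable_from_top (f := fun z => ∫ y', h y' ∂G.stepKernel x y z)).comp
        (measurable_pi_apply (X := fun _ => Outcome S A B) _))).aestronglyMeasurable
  · refine Integrable.of_bound (C := ∑ z : Outcome S A B, ‖h z‖)
      (hh.comp measurable_snd).aestronglyMeasurable
      (Filter.Eventually.of_forall fun p => ?_)
    exact Finset.single_le_sum (f := fun z : Outcome S A B => ‖h z‖) (fun _ _ => norm_nonneg _)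
      (Finset.mem_univ p.2)

open Classical in
-- The Markov property replaces `h` at time `t + 1` by its conditional mean at time `t`, which is a
-- new function of the outcome; hence the induction runs over all `h`. This is what reduces the
-- trajectory measure to powers of a matrix.
theorem integral_trajLaw (x : TeamStrategy S A) (y : AdvStrategy S B) (s : S) (t : ℕ)
    (h : S → (∀ k, A k) → B → ℝ) :
    ∫ ω, h (ω t).state (ω t).team (ω t).adv ∂G.trajLaw x y s
      = (G.transMat x y ^ t).mulVec (stateExp x y h) s := by
  induction t generalizing h with
  | zero =>
    have hm : Measurable fun ω : ℕ → Outcome S A B => ω 0 := measurable_pi_apply 0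
    have h1 := integral_map (μ := G.trajLaw x y s) hm.aemeasurable
      (f := fun z => h z.state z.team z.adv) (measurable_from_top).aestronglyMeasurable
    rw [← h1, map_trajLaw_zero, PMF.integral_eq_finExp, finExp_outcomeLaw]
    simp
  | succ t ih =>
    rw [G.integral_trajLaw_succ x y s t (fun z => h z.state z.team z.adv)]
    simp only [nextLaw, PMF.finExp_bind, simplexPMF_finExp, finExp_outcomeLaw]
    rw [ih fun s a b => ∑ s', G.P s a b s' * stateExp x y h s', ← transMat_mulVec,
      Matrix.mulVec_mulVec, pow_succ]

/-! ### Mixed action profiles -/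

theorem profile_nonneg (x : TeamStrategy S A) (s : S) (k : Fin n) (a : A k) :
    0 ≤ profile x s k a := (x k s).2.1 a

theorem sum_profile (x : TeamStrategy S A) (s : S) (k : Fin n) : ∑ a, profile x s k a = 1 :=
  (x k s).2.2

theorem prod_profile_nonneg {ξ : ∀ k, A k → ℝ} (h0 : ∀ k a, 0 ≤ ξ k a) (a : ∀ k, A k) :
    0 ≤ ∏ k, ξ k (a k) := Finset.prod_nonneg fun k _ => h0 k _

theorem sum_prod_profile {ξ : ∀ k, A k → ℝ} (h1 : ∀ k, ∑ a, ξ k a = 1) :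
    ∑ a : ∀ k, A k, ∏ k, ξ k (a k) = 1 := by
  classical
  rw [← Fintype.prod_sum]
  simp [h1]

theorem PMix_nonneg (s' s : S) {ξ : ∀ k, A k → ℝ} (h0 : ∀ k a, 0 ≤ ξ k a) (b : B) :
    0 ≤ G.PMix s' s ξ b :=
  Finset.sum_nonneg fun a _ => mul_nonneg (prod_profile_nonneg h0 a) ((G.P s a b).2.1 s')

theorem sum_PMix (s : S) {ξ : ∀ k, A k → ℝ} (h1 : ∀ k, ∑ a, ξ k a = 1) (b : B) :
    ∑ s', G.PMix s' s ξ b = 1 := by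
  simp only [PMix]
  rw [Finset.sum_comm]
  simp only [← Finset.mul_sum]
  have : ∀ a, ∑ s', G.P s a b s' = 1 := fun a => (G.P s a b).2.2
  simp only [this, mul_one, sum_prod_profile h1]

/-! ### The transition matrix and its resolvent -/

theorem transMat_nonneg (x : TeamStrategy S A) (y : AdvStrategy S B) (s s' : S) :
    0 ≤ G.transMat x y s s' :=
  Finset.sum_nonneg fun b _ =>
    mul_nonneg ((y s).2.1 b) (G.PMix_nonneg _ _ (profile_nonneg x s) b)

theorem sum_transMat (x : TeamStrategy S A) (y : AdvStrategy S B) (s : S) :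
    ∑ s', G.transMat x y s s' = 1 := by
  simp only [transMat]
  rw [Finset.sum_comm]
  simp only [← Finset.mul_sum, G.sum_PMix s (sum_profile x s), mul_one]
  exact (y s).2.2

open Classical in
theorem transMat_pow_nonneg (x : TeamStrategy S A) (y : AdvStrategy S B) (t : ℕ) (s s' : S) :
    0 ≤ (G.transMat x y ^ t) s s' := by
  induction t generalizing s s' with
  | zero => by_cases h : s = s' <;> simp [h]
  | succ t ih =>
    rw [pow_succ, Matrix.mul_apply]
    exact Finset.sum_nonneg fun u _ => mul_nonneg (ih _ _) (G.transMat_nonneg x y _ _)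

open Classical in
theorem sum_transMat_pow (x : TeamStrategy S A) (y : AdvStrategy S B) (t : ℕ) (s : S) :
    ∑ s', (G.transMat x y ^ t) s s' = 1 := by
  induction t with
  | zero => simp [Matrix.one_apply]
  | succ t ih =>
    simp only [pow_succ, Matrix.mul_apply]
    rw [Finset.sum_comm]
    simp only [← Finset.mul_sum, G.sum_transMat, mul_one, ih]

open Classical in
theorem transMat_pow_le_one (x : TeamStrategy S A) (y : AdvStrategy S B) (t : ℕ) (s s' : S) :
    (G.transMat x y ^ t) s s' ≤ 1 := by
  rw [← G.sum_transMat_pow x y t s]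
  exact Finset.single_le_sum (fun u _ => G.transMat_pow_nonneg x y t s u) (Finset.mem_univ s')

open Classical in
/-- The discounted number of visits of `s'` when starting from `s`. -/
def resolvent (x : TeamStrategy S A) (y : AdvStrategy S B) : Matrix S S ℝ :=
  fun s s' => ∑' t : ℕ, G.γ ^ t * (G.transMat x y ^ t) s s'

open Classical in
theorem hasSum_resolvent (x : TeamStrategy S A) (y : AdvStrategy S B) (s s' : S) :
    HasSum (fun t : ℕ => G.γ ^ t * (G.transMat x y ^ t) s s') (G.resolvent x y s s') := by
  refine Summable.hasSum (Summable.of_nonneg_of_le (fun t => ?_) (fun t => ?_)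
    (summable_geometric_of_lt_one G.γ_nonneg G.γ_lt_one))
  · exact mul_nonneg (pow_nonneg G.γ_nonneg t) (G.transMat_pow_nonneg x y t s s')
  · exact mul_le_of_le_one_right (pow_nonneg G.γ_nonneg t) (G.transMat_pow_le_one x y t s s')

theorem resolvent_nonneg (x : TeamStrategy S A) (y : AdvStrategy S B) (s s' : S) :
    0 ≤ G.resolvent x y s s' :=
  tsum_nonneg fun t => mul_nonneg (pow_nonneg G.γ_nonneg t) (G.transMat_pow_nonneg x y t s s')

open Classical in
-- Split off the term `t = 0` and factor the first transition out of the remaining powers. The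
-- companion identity factors out the last one.
theorem resolvent_eq_left (x : TeamStrategy S A) (y : AdvStrategy S B) (s s' : S) :
    G.resolvent x y s s' = (1 : Matrix S S ℝ) s s'
      + G.γ * ∑ u, G.transMat x y s u * G.resolvent x y u s' := by
  have h1 := (hasSum_nat_add_iff' 1).2 (G.hasSum_resolvent x y s s')
  have h2 := (hasSum_sum (s := Finset.univ) fun u _ =>
    (G.hasSum_resolvent x y u s').mul_left (G.transMat x y s u)).mul_left G.γ
  have h3 := h1.unique (h2.congr_fun ?_)
  · simp only [Finset.range_one, Finset.sum_singleton, pow_zero, one_mul] at h3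
    linarith
  · intro t
    rw [pow_succ', pow_succ', Matrix.mul_apply, Finset.mul_sum, Finset.mul_sum]
    exact Finset.sum_congr rfl fun u _ => by ring

open Classical in
theorem resolvent_eq_right (x : TeamStrategy S A) (y : AdvStrategy S B) (s s' : S) :
    G.resolvent x y s s' = (1 : Matrix S S ℝ) s s'
      + G.γ * ∑ u, G.resolvent x y s u * G.transMat x y u s' := by
  have h1 := (hasSum_nat_add_iff' 1).2 (G.hasSum_resolvent x y s s')
  have h2 := (hasSum_sum (s := Finset.univ) fun u _ =>
    (G.hasSum_resolvent x y s u).mul_right (G.transMat x y u s')).mul_left G.γ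
  have h3 := h1.unique (h2.congr_fun ?_)
  · simp only [Finset.range_one, Finset.sum_singleton, pow_zero, one_mul] at h3
    linarith
  · intro t
    rw [pow_succ', pow_succ, Matrix.mul_apply, Finset.mul_sum, Finset.mul_sum]
    exact Finset.sum_congr rfl fun u _ => by ring

/-! ### Values and visitation measures through the resolvent -/

/-- Rewards lie in `(0, 1)`, so the series is dominated by the geometric one and the expectation can
be taken term by term. -/
theorem V_eq_resolvent (x : TeamStrategy S A) (y : AdvStrategy S B) (s : S) :
    G.V x y s = ∑ u, G.resolvent x y s u * stateExp x y G.r u := by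
  classical
  have hm : ∀ t, Measurable fun ω : ℕ → Outcome S A B =>
      G.γ ^ t * G.r (ω t).state (ω t).team (ω t).adv := fun t =>
    (measurable_from_top (f := fun z : Outcome S A B => G.γ ^ t * G.r z.state z.team z.adv)).comp
      (measurable_pi_apply (X := fun _ => Outcome S A B) t)
  have hb : ∀ (t : ℕ) (ω : ℕ → Outcome S A B),
      ‖G.γ ^ t * G.r (ω t).state (ω t).team (ω t).adv‖ ≤ G.γ ^ t := fun t ω => by
    have hr := G.r_pos (ω t).state (ω t).team (ω t).adv
    have hg := pow_nonneg G.γ_nonneg t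
    rw [Real.norm_of_nonneg (mul_nonneg hg hr.le)]
    exact mul_le_of_le_one_right hg (G.r_lt_one _ _ _).le
  have hi : ∀ t, Integrable (fun ω : ℕ → Outcome S A B =>
      G.γ ^ t * G.r (ω t).state (ω t).team (ω t).adv) (G.trajLaw x y s) := fun t =>
    Integrable.of_bound (hm t).aestronglyMeasurable _ (Filter.Eventually.of_forall (hb t))
  have h1 := hasSum_integral_of_summable_integral_norm hi
    (Summable.of_nonneg_of_le (fun t => integral_nonneg fun ω => norm_nonneg _) (fun t => by
      refine (integral_mono (hi t).norm (integrable_const (G.γ ^ t)) (hb t)).trans ?_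
      simp) (summable_geometric_of_lt_one G.γ_nonneg G.γ_lt_one))
  have h2 := hasSum_sum (s := Finset.univ) fun u _ =>
    (G.hasSum_resolvent x y s u).mul_right (stateExp x y G.r u)
  refine h1.unique (h2.congr_fun fun t => ?_)
  rw [integral_const_mul, G.integral_trajLaw x y s t G.r, Matrix.mulVec, dotProduct,
    Finset.mul_sum]
  exact Finset.sum_congr rfl fun u _ => by ring

theorem stateExp_state (x : TeamStrategy S A) (y : AdvStrategy S B) (f : S → ℝ) (s : S) :
    stateExp x y (fun u _ _ => f u) s = f s := by
  have hy : ∑ b, y s b = 1 := (y s).2.2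
  simp only [stateExp, ← Finset.sum_mul, sum_prod_profile (sum_profile x s), one_mul, hy]

theorem visitation_eq_resolvent (x : TeamStrategy S A) (y : AdvStrategy S B) (s : S) :
    G.visitation x y s = ∑ s₀, G.ρ s₀ * G.resolvent x y s₀ s := by
  classical
  refine Finset.sum_congr rfl fun s₀ _ => congrArg _ (tsum_congr fun t => congrArg _ ?_)
  have hm : MeasurableSet {ω : ℕ → Outcome S A B | (ω t).state = s} :=
    (measurable_pi_apply (X := fun _ => Outcome S A B) t)
      (show MeasurableSet {z : Outcome S A B | z.state = s} from trivial)
  have h := G.integral_trajLaw x y s₀ t fun u _ _ => if u = s then 1 else 0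
  rw [← integral_indicator_one hm]
  refine Eq.trans ?_ (h.trans ?_)
  · refine integral_congr_ae (Filter.Eventually.of_forall fun ω => ?_)
    simp [Set.indicator_apply]
  · simp [Matrix.mulVec, dotProduct, stateExp_state]

end AdvTeamGame

/-! ### Optimality equation of a finite discounted decision process -/

/-- Banach's fixed point theorem for the Bellman operator, a `γ`-contraction in the sup norm. The
action sets depend on the state and the rewards are arbitrary because there are two uses: the
adversary's best response, with all actions, and its linearisation, with tight actions only. -/
theorem exists_optimality_equation {S B : Type*} [Fintype S] (Act : S → Finset B)
    (hAct : ∀ s, (Act s).Nonempty) (R : S → B → ℝ) (P : S → B → S → ℝ)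
    (hP0 : ∀ s b s', 0 ≤ P s b s') (hP1 : ∀ s b, ∑ s', P s b s' = 1) {γ : ℝ} (hγ0 : 0 ≤ γ)
    (hγ1 : γ < 1) :
    ∃ (w : S → ℝ) (y : S → B),
      (∀ s, y s ∈ Act s ∧ w s = R s (y s) + γ * ∑ s', P s (y s) s' * w s') ∧
      ∀ s, ∀ b ∈ Act s, R s b + γ * ∑ s', P s b s' * w s' ≤ w s := by
  let T : (S → ℝ) → S → ℝ := fun w s =>
    (Act s).sup' (hAct s) fun b => R s b + γ * ∑ s', P s b s' * w s'
  have key : ∀ w w' : S → ℝ, ∀ s, T w s ≤ T w' s + γ * dist w w' := fun w w' s => by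
    refine Finset.sup'_le _ _ fun b hb => ?_
    have h1 : R s b + γ * ∑ s', P s b s' * w' s' ≤ T w' s :=
      Finset.le_sup' (fun b => R s b + γ * ∑ s', P s b s' * w' s') hb
    have h2 : ∑ s', P s b s' * w s' ≤ ∑ s', P s b s' * w' s' + dist w w' := by
      calc ∑ s', P s b s' * w s' ≤ ∑ s', P s b s' * (w' s' + dist w w') :=
            Finset.sum_le_sum fun s' _ => mul_le_mul_of_nonneg_left (by
              have := dist_le_pi_dist w w' s'
              rw [Real.dist_eq] at this
              linarith [le_abs_self (w s' - w' s')]) (hP0 s b s')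
        _ = _ := by simp only [mul_add, Finset.sum_add_distrib, ← Finset.sum_mul, hP1, one_mul]
    nlinarith [mul_le_mul_of_nonneg_left h2 hγ0]
  have hT : ContractingWith ⟨γ, hγ0⟩ T := by
    refine ⟨by exact_mod_cast hγ1, LipschitzWith.of_dist_le_mul fun w w' => ?_⟩
    refine (dist_pi_le_iff (mul_nonneg hγ0 dist_nonneg)).2 fun s => ?_
    rw [Real.dist_eq, abs_sub_le_iff]
    have h1 := key w w' s
    have h2 := key w' w s
    rw [dist_comm] at h2
    change _ ≤ γ * dist w w' ∧ _ ≤ γ * dist w w'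
    constructor <;> linarith
  obtain ⟨w, hw⟩ : ∃ w, T w = w := ⟨_, hT.fixedPoint_isFixedPt⟩
  -- The strategy is greedy with respect to the fixed point, so the maximum in the optimality
  -- equation is attained at `y s`.
  choose y hy using fun s => Finset.exists_mem_eq_sup' (hAct s)
    fun b => R s b + γ * ∑ s', P s b s' * w s'
  refine ⟨w, y, fun s => ⟨(hy s).1, ?_⟩, fun s b hb => ?_⟩
  · rw [← (hy s).2]
    exact (congrFun hw s).symm
  · refine le_of_le_of_eq ?_ (congrFun hw s)
    exact Finset.le_sup' (fun b => R s b + γ * ∑ s', P s b s' * w s') hb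

/-- The deterministic strategy of the adversary that plays `y s` in state `s`. -/
def pureAdv {S B : Type*} [Fintype B] (y : S → B) : AdvStrategy S B := by
  classical exact fun s => ⟨Pi.single (y s) 1, single_mem_stdSimplex ℝ (y s)⟩

theorem sum_pureAdv_mul {S B : Type*} [Fintype B] (y : S → B) (s : S) (f : B → ℝ) :
    ∑ b, pureAdv y s b * f b = f (y s) := by
  classical
  have : ∀ b, pureAdv y s b = (Pi.single (y s) 1 : B → ℝ) b := fun b => by
    simp only [pureAdv]
    congr!
  simp [this, Pi.single_apply]

namespace AdvTeamGame

variable {n : ℕ} {S B : Type*} {A : Fin n → Type*} [Fintype S] [∀ k, Fintype (A k)] [Fintype B]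
variable (G : AdvTeamGame S A B)

/-! ### Performance differences -/

theorem sum_mul_bellmanGap (x : TeamStrategy S A) (y : AdvStrategy S B) (v : S → ℝ) (s : S) :
    ∑ b, y s b * G.bellmanGap v s (profile x s) b
      = stateExp x y G.r s + G.γ * ∑ s', G.transMat x y s s' * v s' - v s := by
  have hy : ∑ b, y s b = 1 := (y s).2.2
  have h1 : stateExp x y G.r s = ∑ b, y s b * G.rMix s (profile x s) b := rfl
  have h2 : ∑ s', G.transMat x y s s' * v s'
      = ∑ b, y s b * ∑ s', G.PMix s' s (profile x s) b * v s' := by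
    simp only [transMat, Finset.sum_mul, Finset.mul_sum]
    rw [Finset.sum_comm]
    simp only [mul_assoc]
  have h3 : v s = ∑ b, y s b * v s := by rw [← Finset.sum_mul, hy, one_mul]
  rw [h1, h2]
  conv_rhs => rw [h3]
  rw [Finset.mul_sum, ← Finset.sum_add_distrib, ← Finset.sum_sub_distrib]
  refine Finset.sum_congr rfl fun b _ => ?_
  simp only [bellmanGap]
  ring

/-- The resolvent is a left inverse of `1 - γ P`, by `resolvent_eq_right`. -/
theorem sum_resolvent_mul (x : TeamStrategy S A) (y : AdvStrategy S B) (v : S → ℝ) (s : S) :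
    ∑ u, G.resolvent x y s u * (v u - G.γ * ∑ s', G.transMat x y u s' * v s') = v s := by
  classical
  have h1 : ∑ u, G.resolvent x y s u * v u
      = v s + ∑ u, G.resolvent x y s u * (G.γ * ∑ s', G.transMat x y u s' * v s') := by
    calc ∑ u, G.resolvent x y s u * v u
        = ∑ u, ((1 : Matrix S S ℝ) s u
            + G.γ * ∑ u', G.resolvent x y s u' * G.transMat x y u' u) * v u :=
          Finset.sum_congr rfl fun u _ => by rw [← G.resolvent_eq_right x y s u]
      _ = v s + ∑ u, ∑ u', G.γ * (G.resolvent x y s u' * G.transMat x y u' u) * v u := by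
          simp [add_mul, Finset.sum_add_distrib, Matrix.one_apply, Finset.mul_sum, Finset.sum_mul]
      _ = _ := by
          rw [Finset.sum_comm]
          simp only [Finset.mul_sum]
          congr 1
          exact Finset.sum_congr rfl fun u _ => Finset.sum_congr rfl fun s' _ => by ring
  simp only [mul_sub, Finset.sum_sub_distrib]
  linarith

/-- Performance difference lemma: write `v` as the resolvent applied to `v - γ P v` and subtract it
from the resolvent formula for the value. -/
theorem V_sub_eq (x : TeamStrategy S A) (y : AdvStrategy S B) (v : S → ℝ) (s : S) :
    G.V x y s - v s = ∑ u, G.resolvent x y s u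
      * ∑ b, y u b * G.bellmanGap v u (profile x u) b := by
  have h := G.sum_resolvent_mul x y v s
  simp only [sum_mul_bellmanGap, V_eq_resolvent]
  refine (congrArg (_ - ·) h.symm).trans ?_
  rw [← Finset.sum_sub_distrib]
  exact Finset.sum_congr rfl fun u _ => by ring

theorem Vrho_sub_eq (x : TeamStrategy S A) (y : AdvStrategy S B) (v : S → ℝ) :
    G.Vrho x y - ∑ s, G.ρ s * v s = ∑ u, G.visitation x y u
      * ∑ b, y u b * G.bellmanGap v u (profile x u) b := by
  simp only [Vrho, visitation_eq_resolvent, Finset.sum_mul]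
  rw [← Finset.sum_sub_distrib, Finset.sum_comm]
  refine Finset.sum_congr rfl fun s _ => ?_
  rw [← mul_sub, V_sub_eq, Finset.mul_sum]
  simp only [mul_assoc]

theorem sum_visitation_mul (x : TeamStrategy S A) (y : AdvStrategy S B) (v : S → ℝ) :
    ∑ u, G.visitation x y u * (v u - G.γ * ∑ s', G.transMat x y u s' * v s')
      = ∑ s, G.ρ s * v s := by
  simp only [visitation_eq_resolvent, Finset.sum_mul]
  rw [Finset.sum_comm]
  refine Finset.sum_congr rfl fun s _ => ?_
  refine Eq.trans ?_ (congrArg (G.ρ s * ·) (G.sum_resolvent_mul x y v s))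
  simp only [Finset.mul_sum, mul_assoc]

theorem V_le_of_bellmanGap_nonpos {x : TeamStrategy S A} {v : S → ℝ}
    (h : ∀ s b, G.bellmanGap v s (profile x s) b ≤ 0) (y : AdvStrategy S B) (s : S) :
    G.V x y s ≤ v s := by
  rw [← sub_nonpos, V_sub_eq]
  exact Finset.sum_nonpos fun u _ => mul_nonpos_of_nonneg_of_nonpos (G.resolvent_nonneg _ _ _ _)
    (Finset.sum_nonpos fun b _ => mul_nonpos_of_nonneg_of_nonpos ((y u).2.1 b) (h u b))

/-! ### The visitation measure -/

/-- The visit at time zero already contributes `ρ s`. -/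
theorem ρ_le_visitation (x : TeamStrategy S A) (y : AdvStrategy S B) (s : S) :
    G.ρ s ≤ G.visitation x y s := by
  classical
  have h1 : 1 ≤ G.resolvent x y s s := by
    rw [resolvent_eq_left, Matrix.one_apply_eq]
    refine le_add_of_nonneg_right (mul_nonneg G.γ_nonneg (Finset.sum_nonneg fun u _ => ?_))
    exact mul_nonneg (G.transMat_nonneg _ _ _ _) (G.resolvent_nonneg _ _ _ _)
  rw [visitation_eq_resolvent]
  refine le_trans ?_ (Finset.single_le_sum (f := fun s₀ => G.ρ s₀ * G.resolvent x y s₀ s)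
    (fun u _ => mul_nonneg (G.ρ_pos u).le (G.resolvent_nonneg _ _ _ _)) (Finset.mem_univ s))
  exact le_mul_of_one_le_right (G.ρ_pos s).le h1

theorem visitation_nonneg (x : TeamStrategy S A) (y : AdvStrategy S B) (s : S) :
    0 ≤ G.visitation x y s := (G.ρ_pos s).le.trans (G.ρ_le_visitation x y s)

theorem one_sub_γ_pos : 0 < 1 - G.γ := sub_pos.2 G.γ_lt_one

/-- Testing the flow equation with the constant `1` shows that the total visitation mass is `1 / (1
- γ)`. -/
theorem visitation_le (x : TeamStrategy S A) (y : AdvStrategy S B) (s : S) :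
    G.visitation x y s ≤ 1 / (1 - G.γ) := by
  have hρ : ∑ s, G.ρ s = 1 := G.ρ.2.2
  have h := G.sum_visitation_mul x y fun _ => 1
  simp only [mul_one, sum_transMat, hρ, ← Finset.sum_mul] at h
  rw [le_div_iff₀ G.one_sub_γ_pos]
  refine le_of_le_of_eq ?_ h
  exact mul_le_mul_of_nonneg_right (Finset.single_le_sum
    (fun u _ => G.visitation_nonneg x y u) (Finset.mem_univ s)) G.one_sub_γ_pos.le

/-- Needed because `sSup` of an unbounded set of reals is the default value `0`. Full support of `ρ`
makes the ratios bounded. -/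
theorem bddAbove_mismatch : BddAbove {c | ∃ (x : TeamStrategy S A) (y : AdvStrategy S B),
    c = ‖fun s => G.visitation x y s / G.ρ s‖} := by
  refine ⟨∑ s, 1 / (1 - G.γ) / G.ρ s, ?_⟩
  have h0 : ∀ s, 0 ≤ 1 / (1 - G.γ) / G.ρ s := fun s =>
    div_nonneg (one_div_nonneg.2 G.one_sub_γ_pos.le) (G.ρ_pos s).le
  rintro c ⟨x, y, rfl⟩
  refine (pi_norm_le_iff_of_nonneg (Finset.sum_nonneg fun s _ => h0 s)).2 fun s => ?_
  rw [Real.norm_of_nonneg (div_nonneg (G.visitation_nonneg x y s) (G.ρ_pos s).le)]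
  exact (div_le_div_of_nonneg_right (G.visitation_le x y s) (G.ρ_pos s).le).trans
    (Finset.single_le_sum (fun s _ => h0 s) (Finset.mem_univ s))

theorem visitation_div_le_mismatch (x : TeamStrategy S A) (y : AdvStrategy S B) (s : S) :
    G.visitation x y s / G.ρ s ≤ G.mismatch :=
  ((le_abs_self _).trans (norm_le_pi_norm (fun s => G.visitation x y s / G.ρ s) s)).trans
    (le_csSup G.bddAbove_mismatch ⟨x, y, rfl⟩)

/-! ### Best-response values -/

/-- The solution `w` of the optimality equation has nonpositive gaps, hence dominates every value,
and its greedy strategy has zero gaps, hence attains `w`. So `w` is the best-response value, and one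
deterministic strategy is optimal from all states simultaneously. -/
theorem bellmanGap_optimal [Nonempty B] (x : TeamStrategy S A) :
    (∀ s b, G.bellmanGap (G.bestValue x) s (profile x s) b ≤ 0) ∧
      ∃ y : S → B, (∀ s, G.bellmanGap (G.bestValue x) s (profile x s) (y s) = 0) ∧
        G.bestValue x = G.V x (pureAdv y) := by
  obtain ⟨w, y, hy, hw⟩ := exists_optimality_equation (fun _ : S => (Finset.univ : Finset B))
    (fun _ => Finset.univ_nonempty) (fun s b => G.rMix s (profile x s) b)
    (fun s b s' => G.PMix s' s (profile x s) b)
    (fun s b s' => G.PMix_nonneg s' s (profile_nonneg x s) b)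
    (fun s b => G.sum_PMix s (sum_profile x s) b) G.γ_nonneg G.γ_lt_one
  have hle : ∀ s b, G.bellmanGap w s (profile x s) b ≤ 0 := fun s b =>
    sub_nonpos.2 (hw s b (Finset.mem_univ b))
  have heq : ∀ s, G.bellmanGap w s (profile x s) (y s) = 0 := fun s =>
    sub_eq_zero.2 (hy s).2.symm
  have hV : G.V x (pureAdv y) = w := by
    ext s
    rw [← sub_eq_zero, V_sub_eq]
    refine Finset.sum_eq_zero fun u _ => ?_
    rw [sum_pureAdv_mul, heq, mul_zero]
  have hbest : G.bestValue x = w := by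
    ext s
    have : Nonempty (AdvStrategy S B) := ⟨pureAdv y⟩
    refine le_antisymm (ciSup_le fun y' => G.V_le_of_bellmanGap_nonpos hle y' s) ?_
    rw [← hV]
    exact le_ciSup (f := fun y' => G.V x y' s)
      ⟨w s, by rintro _ ⟨y', rfl⟩; exact G.V_le_of_bellmanGap_nonpos hle y' s⟩ (pureAdv y)
  rw [hbest]
  exact ⟨hle, y, heq, hV.symm⟩

theorem V_le_bestValue [Nonempty B] (x : TeamStrategy S A) (y : AdvStrategy S B) (s : S) :
    G.V x y s ≤ G.bestValue x s :=
  G.V_le_of_bellmanGap_nonpos (G.bellmanGap_optimal x).1 y s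

theorem Vrho_le_bestValue [Nonempty B] (x : TeamStrategy S A) (y : AdvStrategy S B) :
    G.Vrho x y ≤ ∑ s, G.ρ s * G.bestValue x s :=
  Finset.sum_le_sum fun s _ => mul_le_mul_of_nonneg_left (G.V_le_bestValue x y s) (G.ρ_pos s).le

theorem phi_eq [Nonempty B] (x : TeamStrategy S A) :
    G.phi x = ∑ s, G.ρ s * G.bestValue x s := by
  obtain ⟨y, -, hy⟩ := (G.bellmanGap_optimal x).2
  have : Nonempty (AdvStrategy S B) := ⟨pureAdv y⟩
  refine le_antisymm (ciSup_le fun y' => G.Vrho_le_bestValue x y') ?_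
  rw [hy]
  exact le_ciSup (f := fun y' => G.Vrho x y')
    ⟨_, by rintro _ ⟨y', rfl⟩; exact G.Vrho_le_bestValue x y'⟩ (pureAdv y)

theorem bestValue_le_of_bellmanGap_nonpos [Nonempty B] {x : TeamStrategy S A} {v : S → ℝ}
    (h : ∀ s b, G.bellmanGap v s (profile x s) b ≤ 0) (s : S) : G.bestValue x s ≤ v s := by
  obtain ⟨y, -, hy⟩ := (G.bellmanGap_optimal x).2
  rw [hy]
  exact G.V_le_of_bellmanGap_nonpos h _ s

/-! ### Bounds on mixed rewards and best-response values. -/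

theorem rMix_nonneg (s : S) {ξ : ∀ k, A k → ℝ} (h0 : ∀ k a, 0 ≤ ξ k a) (b : B) :
    0 ≤ G.rMix s ξ b :=
  Finset.sum_nonneg fun a _ => mul_nonneg (prod_profile_nonneg h0 a) (G.r_pos s a b).le

theorem rMix_le_one (s : S) {ξ : ∀ k, A k → ℝ} (h0 : ∀ k a, 0 ≤ ξ k a)
    (h1 : ∀ k, ∑ a, ξ k a = 1) (b : B) : G.rMix s ξ b ≤ 1 := by
  rw [← sum_prod_profile h1]
  exact Finset.sum_le_sum fun a _ =>
    mul_le_of_le_one_right (prod_profile_nonneg h0 a) (G.r_lt_one s a b).le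

theorem bestValue_nonneg [Nonempty B] (x : TeamStrategy S A) (s : S) : 0 ≤ G.bestValue x s := by
  obtain ⟨y, -, hy⟩ := (G.bellmanGap_optimal x).2
  rw [hy, V_eq_resolvent]
  refine Finset.sum_nonneg fun u _ => mul_nonneg (G.resolvent_nonneg _ _ _ _)
    (Finset.sum_nonneg fun b _ => mul_nonneg ((pureAdv y u).2.1 b) ?_)
  exact G.rMix_nonneg u (profile_nonneg x u) b

theorem bestValue_le [Nonempty B] (x : TeamStrategy S A) (s : S) :
    G.bestValue x s ≤ 1 / (1 - G.γ) := by
  refine G.bestValue_le_of_bellmanGap_nonpos (v := fun _ => 1 / (1 - G.γ)) (fun u b => ?_) s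
  have h := G.rMix_le_one u (profile_nonneg x u) (sum_profile x u) b
  have hg := G.one_sub_γ_pos
  simp only [bellmanGap, ← Finset.sum_mul, G.sum_PMix u (sum_profile x u), one_mul]
  have : G.γ * (1 / (1 - G.γ)) - 1 / (1 - G.γ) = -1 := by field_simp; ring
  linarith

end AdvTeamGame

/-! ### Expectations under product action profiles -/

section MixExp

variable {n : ℕ} {A : Fin n → Type*} [∀ k, Fintype (A k)]

/-- The expectation of `f` under the mixed action profile `ξ`. -/
def mixExp (ξ : ∀ k, A k → ℝ) (f : (∀ k, A k) → ℝ) : ℝ := ∑ a, (∏ k, ξ k (a k)) * f a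

theorem prod_update_apply (ξ : ∀ k, A k → ℝ) (k : Fin n) (u : A k → ℝ) (a : ∀ k, A k) :
    ∏ j, Function.update ξ k u j (a j) = u (a k) * ∏ j ∈ Finset.univ.erase k, ξ j (a j) := by
  rw [← Finset.mul_prod_erase Finset.univ _ (Finset.mem_univ k), Function.update_self]
  congr 1
  refine Finset.prod_congr rfl fun j hj => ?_
  rw [Function.update_of_ne (Finset.ne_of_mem_erase hj)]

/-- Isolates the dependence on one coordinate, which is linear; the vector `u` may be signed, as
derivatives and differences of strategies require. -/
theorem mixExp_update (ξ : ∀ k, A k → ℝ) (k : Fin n) (u : A k → ℝ) (f : (∀ k, A k) → ℝ) :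
    mixExp (Function.update ξ k u) f
      = ∑ a, u (a k) * ((∏ j ∈ Finset.univ.erase k, ξ j (a j)) * f a) := by
  simp only [mixExp, prod_update_apply, mul_assoc]

open Classical in
theorem mixExp_update_eq_sum (ξ : ∀ k, A k → ℝ) (k : Fin n) (u : A k → ℝ)
    (f : (∀ k, A k) → ℝ) :
    mixExp (Function.update ξ k u) f
      = ∑ a', u a' * mixExp (Function.update ξ k (Pi.single a' 1)) f := by
  simp only [mixExp_update, Finset.mul_sum]
  rw [Finset.sum_comm]
  refine Finset.sum_congr rfl fun a _ => ?_
  simp [Pi.single_apply]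

theorem mixExp_update_sub (ξ : ∀ k, A k → ℝ) (k : Fin n) (u u' : A k → ℝ)
    (f : (∀ k, A k) → ℝ) :
    mixExp (Function.update ξ k (u - u')) f
      = mixExp (Function.update ξ k u) f - mixExp (Function.update ξ k u') f := by
  simp only [mixExp_update, Pi.sub_apply, sub_mul, Finset.sum_sub_distrib]

open Classical in
-- The direction is `∑ a', c a' • (e_{a'} - ξ k)`, so by linearity it yields the weighted advantages
-- of the pure actions.
theorem mixExp_update_direction (ξ : ∀ k, A k → ℝ) (k : Fin n) (c : A k → ℝ)
    (f : (∀ k, A k) → ℝ) :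
    mixExp (Function.update ξ k fun a => c a - (∑ a', c a') * ξ k a) f
      = ∑ a', c a' * (mixExp (Function.update ξ k (Pi.single a' 1)) f - mixExp ξ f) := by
  have h : mixExp ξ f = ∑ a', ξ k a' * mixExp (Function.update ξ k (Pi.single a' 1)) f := by
    rw [← mixExp_update_eq_sum, Function.update_eq_self]
  rw [mixExp_update_eq_sum]
  simp only [mul_sub, sub_mul, Finset.sum_sub_distrib, ← Finset.sum_mul]
  conv_rhs => rw [h]
  rw [Finset.mul_sum]
  simp only [mul_assoc]

theorem abs_mixExp_update_le {ξ : ∀ k, A k → ℝ} (h0 : ∀ k a, 0 ≤ ξ k a)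
    (h1 : ∀ k, ∑ a, ξ k a = 1) (k : Fin n) (u : A k → ℝ) {f : (∀ k, A k) → ℝ} {C : ℝ}
    (hf : ∀ a, |f a| ≤ C) :
    |mixExp (Function.update ξ k u) f| ≤ C * ∑ a, |u a| := by
  have h2 : mixExp (Function.update ξ k fun a => |u a|) (fun _ => 1) = ∑ a, |u a| := by
    simp only [mixExp, mul_one]
    rw [← Fintype.prod_sum, ← Finset.mul_prod_erase Finset.univ _ (Finset.mem_univ k),
      Finset.prod_eq_one fun j hj => ?_, Function.update_self, mul_one]
    rw [Function.update_of_ne (Finset.ne_of_mem_erase hj), h1]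
  rw [← h2, mixExp_update, mixExp_update, Finset.mul_sum]
  refine (Finset.abs_sum_le_sum_abs _ _).trans (Finset.sum_le_sum fun a _ => ?_)
  have hQ : 0 ≤ ∏ j ∈ Finset.univ.erase k, ξ j (a j) := Finset.prod_nonneg fun j _ => h0 _ _
  rw [abs_mul, abs_mul, abs_of_nonneg hQ]
  have := mul_le_mul_of_nonneg_left (hf a) (mul_nonneg (abs_nonneg (u (a k))) hQ)
  linarith

/-- Hybrid argument: exchange the players' mixed actions one at a time; each exchange changes a
single coordinate and costs `C` times its `ℓ¹` distance. -/
theorem abs_mixExp_sub_le {ξ ξ' : ∀ k, A k → ℝ} (h0 : ∀ k a, 0 ≤ ξ k a)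
    (h1 : ∀ k, ∑ a, ξ k a = 1) (h0' : ∀ k a, 0 ≤ ξ' k a) (h1' : ∀ k, ∑ a, ξ' k a = 1)
    {f : (∀ k, A k) → ℝ} {C : ℝ} (hf : ∀ a, |f a| ≤ C) :
    |mixExp ξ f - mixExp ξ' f| ≤ C * ∑ k, ∑ a, |ξ k a - ξ' k a| := by
  have key : ∀ s : Finset (Fin n), |mixExp (s.piecewise ξ ξ') f - mixExp ξ' f|
      ≤ C * ∑ k ∈ s, ∑ a, |ξ k a - ξ' k a| := by
    intro s
    induction s using Finset.induction_on with
    | empty => simp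
    | insert k s hk ih =>
      set h := s.piecewise ξ ξ' with hh
      have hk' : Function.update h k (ξ' k) = h := by
        rw [← Finset.piecewise_eq_of_notMem s ξ ξ' hk]
        exact Function.update_eq_self k h
      have e : mixExp ((insert k s).piecewise ξ ξ') f - mixExp h f
          = mixExp (Function.update h k (ξ k - ξ' k)) f := by
        rw [mixExp_update_sub, hk', Finset.piecewise_insert]
      have hb := abs_mixExp_update_le (ξ := h)
        (fun j a => by by_cases hj : j ∈ s <;> simp [hh, hj, h0, h0'])
        (fun j => by by_cases hj : j ∈ s <;> simp [hh, hj, h1, h1']) k (ξ k - ξ' k) hf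
      rw [← e] at hb
      rw [Finset.sum_insert hk, mul_add]
      have ht := abs_sub_le (mixExp ((insert k s).piecewise ξ ξ') f) (mixExp h f) (mixExp ξ' f)
      simp only [Pi.sub_apply] at hb
      linarith
  simpa using key Finset.univ

theorem hasDerivAt_mixExp {ξ : ℝ → ∀ k, A k → ℝ} {d : ∀ k, A k → ℝ} {t : ℝ}
    (h : ∀ k a, HasDerivAt (fun t => ξ t k a) (d k a) t) (f : (∀ k, A k) → ℝ) :
    HasDerivAt (fun t => mixExp (ξ t) f) (∑ k, mixExp (Function.update (ξ t) k (d k)) f) t := by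
  have h1 : HasDerivAt (fun t => mixExp (ξ t) f)
      (∑ a : ∀ k, A k, (∑ k, (∏ j ∈ Finset.univ.erase k, ξ t j (a j)) • d k (a k)) * f a) t :=
    HasDerivAt.fun_sum fun a _ =>
      (HasDerivAt.fun_finsetProd fun k _ => h k (a k)).mul_const (f a)
  convert h1 using 1
  simp only [mixExp_update, Finset.sum_mul]
  rw [Finset.sum_comm]
  refine Finset.sum_congr rfl fun a _ => Finset.sum_congr rfl fun k _ => ?_
  rw [smul_eq_mul]
  ring

end MixExp

/-! ### The Euclidean distance between team strategies. -/

theorem l2dist_nonneg {n : ℕ} {S : Type*} {A : Fin n → Type*} [Fintype S] [∀ k, Fintype (A k)]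
    (x x' : TeamStrategy S A) : 0 ≤ l2dist x x' := Real.sqrt_nonneg _

theorem sq_l2dist {n : ℕ} {S : Type*} {A : Fin n → Type*} [Fintype S] [∀ k, Fintype (A k)]
    (x x' : TeamStrategy S A) :
    l2dist x x' ^ 2 = ∑ k, ∑ s, ∑ a, (x k s a - x' k s a) ^ 2 :=
  Real.sq_sqrt (Finset.sum_nonneg fun _ _ => Finset.sum_nonneg fun _ _ =>
    Finset.sum_nonneg fun _ _ => sq_nonneg _)

theorem l2dist_comm {n : ℕ} {S : Type*} {A : Fin n → Type*} [Fintype S] [∀ k, Fintype (A k)]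
    (x x' : TeamStrategy S A) : l2dist x x' = l2dist x' x := by
  rw [← Real.sqrt_sq (l2dist_nonneg x x'), ← Real.sqrt_sq (l2dist_nonneg x' x), sq_l2dist,
    sq_l2dist]
  refine congrArg Real.sqrt (Finset.sum_congr rfl fun k _ => Finset.sum_congr rfl fun s _ =>
    Finset.sum_congr rfl fun a _ => ?_)
  ring

namespace AdvTeamGame

variable {n : ℕ} {S B : Type*} {A : Fin n → Type*} [Fintype S] [∀ k, Fintype (A k)] [Fintype B]
variable (G : AdvTeamGame S A B)

/-! ### Bellman gaps as functions of the mixed action profile. -/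

theorem bellmanGap_eq_mixExp (v : S → ℝ) (s : S) (ξ : ∀ k, A k → ℝ) (b : B) :
    G.bellmanGap v s ξ b
      = mixExp ξ (fun a => G.r s a b + G.γ * ∑ s', G.P s a b s' * v s') - v s := by
  have h : ∑ s', G.PMix s' s ξ b * v s' = mixExp ξ fun a => ∑ s', G.P s a b s' * v s' := by
    simp only [PMix, mixExp, Finset.sum_mul, Finset.mul_sum]
    rw [Finset.sum_comm]
    simp only [mul_assoc]
  rw [bellmanGap, h]
  simp only [mixExp, rMix, mul_add, Finset.sum_add_distrib]
  congr 2
  rw [Finset.mul_sum]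
  exact Finset.sum_congr rfl fun a _ => by ring

theorem bellmanGap_update_eq_sum (v : S → ℝ) (x : TeamStrategy S A) (s : S) (k : Fin n)
    (u : stdSimplex ℝ (A k)) (b : B) :
    G.bellmanGap v s (Function.update (profile x s) k fun a => u a) b
      = ∑ a, u a * G.bellmanGap v s (pureDeviation x s k a) b := by
  have h1 : ∑ a, u a = 1 := u.2.2
  simp only [bellmanGap_eq_mixExp, mul_sub, Finset.sum_sub_distrib, ← Finset.sum_mul, h1, one_mul]
  rw [mixExp_update_eq_sum]
  rfl

theorem pureDeviation_nonneg (x : TeamStrategy S A) (s : S) (k : Fin n) (a : A k) (j : Fin n)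
    (a' : A j) : 0 ≤ pureDeviation x s k a j a' := by
  classical
  rcases eq_or_ne j k with rfl | hj
  · by_cases h : a' = a <;> simp [pureDeviation, h]
  · simpa [pureDeviation, hj] using profile_nonneg x s j a'

theorem sum_pureDeviation (x : TeamStrategy S A) (s : S) (k : Fin n) (a : A k) (j : Fin n) :
    ∑ a', pureDeviation x s k a j a' = 1 := by
  classical
  rcases eq_or_ne j k with rfl | hj
  · simp [pureDeviation, Pi.single_apply]
  · simpa [pureDeviation, hj] using sum_profile x s j

theorem sum_abs_pureDeviation_sub_le (x x' : TeamStrategy S A) (s : S) (k : Fin n) (a : A k) :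
    ∑ j, ∑ a', |pureDeviation x s k a j a' - pureDeviation x' s k a j a'|
      ≤ ∑ j, ∑ a', |profile x s j a' - profile x' s j a'| := by
  classical
  refine Finset.sum_le_sum fun j _ => Finset.sum_le_sum fun a' _ => ?_
  rcases eq_or_ne j k with rfl | hj
  · simp [pureDeviation]
  · simp [pureDeviation, hj]

/-- Cauchy–Schwarz over the `∑ₖ Aₖ` coordinates belonging to the state `s`, dropping the other
states from the distance. -/
theorem sum_abs_profile_sub_le (x x' : TeamStrategy S A) (s : S) :
    ∑ k, ∑ a, |profile x s k a - profile x' s k a| ≤ Real.sqrt G.sumA * l2dist x x' := by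
  refine abs_le_of_sq_le_sq' ?_ (mul_nonneg (Real.sqrt_nonneg _) (l2dist_nonneg _ _)) |>.2
  have hA : 0 ≤ G.sumA := Finset.sum_nonneg fun _ _ => Nat.cast_nonneg _
  rw [mul_pow, Real.sq_sqrt hA, sq_l2dist]
  have h1 := sq_sum_le_card_mul_sum_sq (s := (Finset.univ : Finset (Σ k, A k)))
    (f := fun p => |profile x s p.1 p.2 - profile x' s p.1 p.2|)
  rw [Fintype.sum_sigma, Fintype.sum_sigma, Finset.card_univ, Fintype.card_sigma] at h1
  simp only [sq_abs] at h1
  push_cast at h1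
  refine h1.trans (mul_le_mul_of_nonneg_left (Finset.sum_le_sum fun k _ => ?_) hA)
  exact Finset.single_le_sum (f := fun s => ∑ a, (x k s a - x' k s a) ^ 2)
    (fun _ _ => Finset.sum_nonneg fun _ _ => sq_nonneg _) (Finset.mem_univ s)

/-! ### Perturbation of the Bellman gap and of the best-response values -/

theorem abs_bellmanGap_sub_le {v : S → ℝ} (hv0 : ∀ s, 0 ≤ v s) (hv1 : ∀ s, v s ≤ 1 / (1 - G.γ))
    (s : S) {ξ ξ' : ∀ k, A k → ℝ} (h0 : ∀ k a, 0 ≤ ξ k a)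
    (h1 : ∀ k, ∑ a, ξ k a = 1) (h0' : ∀ k a, 0 ≤ ξ' k a) (h1' : ∀ k, ∑ a, ξ' k a = 1) (b : B) :
    |G.bellmanGap v s ξ b - G.bellmanGap v s ξ' b|
      ≤ 1 / (1 - G.γ) * ∑ k, ∑ a, |ξ k a - ξ' k a| := by
  rw [bellmanGap_eq_mixExp, bellmanGap_eq_mixExp, sub_sub_sub_cancel_right]
  refine abs_mixExp_sub_le h0 h1 h0' h1' fun a => ?_
  have hP : ∑ s', G.P s a b s' = 1 := (G.P s a b).2.2
  have h2 : 0 ≤ ∑ s', G.P s a b s' * v s' :=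
    Finset.sum_nonneg fun s' _ => mul_nonneg ((G.P s a b).2.1 s') (hv0 s')
  have h3 : ∑ s', G.P s a b s' * v s' ≤ 1 / (1 - G.γ) := by
    refine le_of_le_of_eq ?_ ((Finset.sum_mul _ _ (1 / (1 - G.γ))).symm.trans (by rw [hP, one_mul]))
    exact Finset.sum_le_sum fun s' _ => mul_le_mul_of_nonneg_left (hv1 s') ((G.P s a b).2.1 s')
  have hr := G.r_pos s a b
  have hr' := G.r_lt_one s a b
  have hg := G.one_sub_γ_pos
  rw [abs_of_nonneg (add_nonneg hr.le (mul_nonneg G.γ_nonneg h2))]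
  have h4 := mul_le_mul_of_nonneg_left h3 G.γ_nonneg
  -- The integrand lies between `0` and `1 + γ / (1 - γ) = 1 / (1 - γ)`, which is the Lipschitz
  -- constant.
  have h5 : 1 + G.γ * (1 / (1 - G.γ)) = 1 / (1 - G.γ) := by field_simp; ring
  linarith

theorem bellmanGap_sub_value (v v' : S → ℝ) (s : S) (ξ : ∀ k, A k → ℝ) (b : B) :
    G.bellmanGap v s ξ b - G.bellmanGap v' s ξ b
      = G.γ * ∑ s', G.PMix s' s ξ b * (v s' - v' s') - (v s - v' s) := by
  simp only [bellmanGap, mul_sub, Finset.sum_sub_distrib]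
  ring

theorem abs_bellmanGap_sub_value_le {v v' : S → ℝ} {δ : ℝ} (hδ : ∀ s, |v s - v' s| ≤ δ)
    (s : S) {ξ : ∀ k, A k → ℝ} (h0 : ∀ k a, 0 ≤ ξ k a) (h1 : ∀ k, ∑ a, ξ k a = 1) (b : B) :
    |G.bellmanGap v s ξ b - G.bellmanGap v' s ξ b| ≤ (G.γ + 1) * δ := by
  rw [bellmanGap_sub_value]
  have h2 : |∑ s', G.PMix s' s ξ b * (v s' - v' s')| ≤ δ := by
    refine (Finset.abs_sum_le_sum_abs _ _).trans ?_
    rw [← one_mul δ, ← G.sum_PMix s h1 b, Finset.sum_mul]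
    refine Finset.sum_le_sum fun s' _ => ?_
    rw [abs_mul, abs_of_nonneg (G.PMix_nonneg s' s h0 b)]
    exact mul_le_mul_of_nonneg_left (hδ s') (G.PMix_nonneg s' s h0 b)
  refine (abs_sub _ _).trans ?_
  rw [abs_mul, abs_of_nonneg G.γ_nonneg]
  have := mul_le_mul_of_nonneg_left h2 G.γ_nonneg
  linarith [hδ s]

/-- Raising a value vector by a constant `δ` lowers its gaps by `(1 - γ) δ`. The `δ` here exactly
absorbs the change of the gap from `x'` to `x`, so the raised best-response value at `x'` has
nonpositive gaps at `x`. -/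
theorem bestValue_le_add [Nonempty B] (x x' : TeamStrategy S A) (s : S) :
    G.bestValue x s
      ≤ G.bestValue x' s + Real.sqrt G.sumA * l2dist x x' / (1 - G.γ) ^ 2 := by
  have hg := G.one_sub_γ_pos
  set δ := Real.sqrt G.sumA * l2dist x x' / (1 - G.γ) ^ 2 with hδ
  refine G.bestValue_le_of_bellmanGap_nonpos (v := fun s => G.bestValue x' s + δ)
    (fun u b => ?_) s
  have h1 := G.bellmanGap_sub_value (fun s => G.bestValue x' s + δ) (G.bestValue x') u
    (profile x u) b
  simp only [add_sub_cancel_left, ← Finset.sum_mul, G.sum_PMix u (sum_profile x u), one_mul] at h1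
  have h2 := G.abs_bellmanGap_sub_le (G.bestValue_nonneg x') (G.bestValue_le x') u
    (profile_nonneg x u) (sum_profile x u) (profile_nonneg x' u) (sum_profile x' u) b
  have h3 := (G.bellmanGap_optimal x').1 u b
  have h4 := mul_le_mul_of_nonneg_left (G.sum_abs_profile_sub_le x x' u)
    (one_div_nonneg.2 hg.le)
  have h5 : 1 / (1 - G.γ) * (Real.sqrt G.sumA * l2dist x x') = (1 - G.γ) * δ := by
    rw [hδ]; field_simp
  have h6 := (abs_le.1 h2).2
  linarith

theorem abs_bestValue_sub_le [Nonempty B] (x x' : TeamStrategy S A) (s : S) :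
    |G.bestValue x s - G.bestValue x' s| ≤ Real.sqrt G.sumA * l2dist x x' / (1 - G.γ) ^ 2 := by
  have h1 := G.bestValue_le_add x x' s
  have h2 := G.bestValue_le_add x' x s
  rw [l2dist_comm x' x] at h2
  exact abs_sub_le_iff.2 ⟨by linarith, by linarith⟩

theorem numS_ge_one : 1 ≤ G.numS := by
  have : Nonempty S := by
    by_contra h
    rw [not_nonempty_iff] at h
    have h1 : ∑ s, G.ρ s = 1 := G.ρ.2.2
    simp at h1
  exact Nat.one_le_cast.2 (Fintype.card_pos (α := S))

theorem sumA_nonneg : 0 ≤ G.sumA := Finset.sum_nonneg fun _ _ => Nat.cast_nonneg _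

theorem L_nonneg : 0 ≤ G.L := div_nonneg (Real.sqrt_nonneg _) (sq_nonneg _)

theorem c₂_nonneg : 0 ≤ G.c₂ := by
  have h1 := G.one_sub_γ_pos
  have h2 := G.γ_nonneg
  have h3 := G.L_nonneg
  have h4 : 0 ≤ G.numS := zero_le_one.trans G.numS_ge_one
  rw [c₂]
  positivity

/-- Moving from `x'` to `x` changes the Bellman gaps of the best-response values by at most
`(1 - γ) c₂ ‖x - x'‖`. -/
theorem abs_bellmanGap_bestValue_sub_le [Nonempty B] (x x' : TeamStrategy S A) {ε : ℝ}
    (hε : l2dist x x' ≤ ε) (s : S) {ξ ξ' : ∀ k, A k → ℝ} (h0 : ∀ k a, 0 ≤ ξ k a)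
    (h1 : ∀ k, ∑ a, ξ k a = 1) (h0' : ∀ k a, 0 ≤ ξ' k a) (h1' : ∀ k, ∑ a, ξ' k a = 1)
    (hξ : ∑ k, ∑ a, |ξ k a - ξ' k a| ≤ ∑ k, ∑ a, |profile x s k a - profile x' s k a|) (b : B) :
    |G.bellmanGap (G.bestValue x) s ξ b - G.bellmanGap (G.bestValue x') s ξ' b|
      ≤ (1 - G.γ) * (G.c₂ * ε) := by
  have hg := G.one_sub_γ_pos
  have hγ := G.γ_nonneg
  have hS := G.numS_ge_one
  have hε0 : 0 ≤ ε := (l2dist_nonneg x x').trans hε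
  have hL := G.L_nonneg
  have hL' : ∀ s, |G.bestValue x s - G.bestValue x' s| ≤ G.L * ε := fun s => by
    refine (G.abs_bestValue_sub_le x x' s).trans ?_
    rw [L, div_mul_eq_mul_div]
    refine div_le_div_of_nonneg_right (mul_le_mul (Real.sqrt_le_sqrt ?_) hε (l2dist_nonneg _ _)
      (Real.sqrt_nonneg _)) (sq_nonneg _)
    exact le_add_of_nonneg_right (Nat.cast_nonneg _)
  have e1 := G.abs_bellmanGap_sub_le (G.bestValue_nonneg x) (G.bestValue_le x) s h0 h1 h0' h1' b
  have e2 := G.abs_bellmanGap_sub_value_le hL' s h0' h1' b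
  have e3 : 1 / (1 - G.γ) * ∑ k, ∑ a, |ξ k a - ξ' k a|
      ≤ 1 / (1 - G.γ) * (Real.sqrt G.sumA * ε) :=
    mul_le_mul_of_nonneg_left ((hξ.trans (G.sum_abs_profile_sub_le x x' s)).trans
      (mul_le_mul_of_nonneg_left hε (Real.sqrt_nonneg _))) (one_div_nonneg.2 hg.le)
  -- `c₂` is larger than necessary: the surplus over the two perturbation errors carries the factor
  -- `S - 1`, which is nonnegative.
  have e4 : (1 - G.γ) * (G.c₂ * ε) = 1 / (1 - G.γ) * (Real.sqrt G.sumA * ε) + (G.γ + 1) * (G.L * ε)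
      + (G.numS - 1) * (G.γ * (Real.sqrt G.sumA * (1 / (1 - G.γ))) + G.γ * G.L) * ε := by
    rw [c₂]
    field_simp
    ring
  have e5 : 0 ≤ (G.numS - 1) * (G.γ * (Real.sqrt G.sumA * (1 / (1 - G.γ))) + G.γ * G.L) * ε := by
    have := sub_nonneg.2 hS
    positivity
  have e6 := abs_sub_le (G.bellmanGap (G.bestValue x) s ξ b)
    (G.bellmanGap (G.bestValue x) s ξ' b) (G.bellmanGap (G.bestValue x') s ξ' b)
  linarith

end AdvTeamGame

/-! ### A theorem of the alternative -/

/-- Ville's theorem of the alternative. -/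
theorem exists_simplex_nonneg_or_exists_neg {Y I : Type*} [Fintype Y] [Fintype I]
    (z : Y → I → ℝ) :
    (∃ p : stdSimplex ℝ Y, ∀ i, 0 ≤ ∑ y, p y * z y i) ∨
      ∃ c : I → ℝ, (∀ i, 0 ≤ c i) ∧ ∀ y, ∑ i, c i * z y i < 0 := by
  classical
  let T : (Y → ℝ) →ₗ[ℝ] (I → ℝ) := Fintype.linearCombination ℝ z
  have hT : ∀ p i, T p i = ∑ y, p y * z y i := fun p i => by
    simp [T, Fintype.linearCombination_apply]
  by_cases hd : Disjoint (T '' stdSimplex ℝ Y) (Set.Ici 0)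
  -- The convex hull of the rows is compact; if it misses the nonnegative orthant, the coefficients
  -- of a strictly separating functional are the required weights.
  · right
    obtain ⟨f, u, v, hu, huv, hv⟩ := geometric_hahn_banach_compact_closed
      ((convex_stdSimplex ℝ Y).linear_image T)
      ((isCompact_stdSimplex ℝ Y).image T.continuous_of_finiteDimensional)
      (convex_Ici (0 : I → ℝ)) isClosed_Ici hd
    have hv0 : v < 0 := by simpa using hv 0 (Set.mem_Ici.2 le_rfl)
    refine ⟨fun i => f (Pi.single i 1), fun i => ?_, fun y => ?_⟩
    · by_contra hneg
      rw [not_le] at hneg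
      -- A negative coefficient would allow a multiple of the basis vector at which `f` equals `v`,
      -- but `f > v` on the orthant.
      have ht : 0 ≤ v / f (Pi.single i 1) := (div_pos_of_neg_of_neg hv0 hneg).le
      have h1 := hv ((v / f (Pi.single i 1)) • Pi.single i 1)
        (Set.mem_Ici.2 (smul_nonneg ht (Pi.single_nonneg.2 zero_le_one)))
      rw [map_smul, smul_eq_mul, div_mul_cancel₀ _ hneg.ne] at h1
      exact lt_irrefl _ h1
    · have h1 : z y = T (Pi.single y 1) := by
        ext i
        simp [hT, Pi.single_apply]
      have h2 := hu (z y) ⟨Pi.single y 1, single_mem_stdSimplex ℝ y, h1.symm⟩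
      have h3 : f (z y) = ∑ i, f (Pi.single i 1) * z y i := by
        have := LinearMap.pi_apply_eq_sum_univ (f : (I → ℝ) →ₗ[ℝ] ℝ) (z y)
        simp only [ContinuousLinearMap.coe_coe, smul_eq_mul] at this
        rw [this]
        refine Finset.sum_congr rfl fun i _ => ?_
        rw [mul_comm]
        congr 2
        ext j
        simp [Pi.single_apply, eq_comm]
      linarith
  · left
    obtain ⟨_, ⟨p, hp, rfl⟩, h⟩ := Set.not_disjoint_iff.1 hd
    refine ⟨⟨p, hp⟩, fun i => ?_⟩
    have := h i
    rw [hT] at this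
    exact this

/-! ### First-order optimality and Lagrange multipliers. -/

theorem eventually_lt_of_hasDerivAt_neg {f : ℝ → ℝ} {f' : ℝ} (h : HasDerivAt f f' 0)
    (hf' : f' < 0) : ∀ᶠ t in nhdsWithin 0 (Set.Ioi 0), f t < f 0 := by
  have h1 := (hasDerivAt_iff_tendsto_slope.1 h).mono_left
    (nhdsWithin_mono 0 fun t (ht : 0 < t) => (ne_of_gt ht : t ≠ 0))
  filter_upwards [h1.eventually (gt_mem_nhds hf'), self_mem_nhdsWithin] with t ht ht0
  have ht0' : (0 : ℝ) < t := ht0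
  rw [slope_def_field, sub_zero, div_neg_iff] at ht
  rcases ht with ht | ht
  · exact absurd ht.2 (not_lt.2 ht0'.le)
  · linarith [ht.1]

theorem pureAdv_apply_of_ne {S B : Type*} [Fintype B] (y : S → B) {s : S} {b : B}
    (h : b ≠ y s) : pureAdv y s b = 0 := by
  classical
  have : pureAdv y s b = (Pi.single (y s) 1 : B → ℝ) b := by
    simp only [pureAdv]
    congr!
  rw [this, Pi.single_eq_of_ne h]

namespace AdvTeamGame

variable {n : ℕ} {S B : Type*} {A : Fin n → Type*} [Fintype S] [∀ k, Fintype (A k)] [Fintype B]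
variable (G : AdvTeamGame S A B)

/-- The shift of the values enters as `t` times a differentiable function, so only the value of that
function at `t = 0` contributes. -/
theorem hasDerivAt_bellmanGap (v w : S → ℝ) (s : S) (b : B) {ξ : ℝ → ∀ k, A k → ℝ}
    {d : ∀ k, A k → ℝ} (h : ∀ k a, HasDerivAt (fun t => ξ t k a) (d k a) 0) :
    HasDerivAt (fun t => G.bellmanGap (fun s => v s + t * w s) s (ξ t) b)
      (∑ k, mixExp (Function.update (ξ 0) k (d k))
          (fun a => G.r s a b + G.γ * ∑ s', G.P s a b s' * v s')
        + (G.γ * ∑ s', G.PMix s' s (ξ 0) b * w s' - w s)) 0 := by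
  have h1 := (hasDerivAt_mixExp h
    fun a => G.r s a b + G.γ * ∑ s', G.P s a b s' * v s').sub_const (v s)
  have h2 := (hasDerivAt_id (0 : ℝ)).mul (((HasDerivAt.fun_sum (u := Finset.univ) fun s' _ =>
    (hasDerivAt_mixExp h fun a => G.P s a b s').mul_const (w s')).const_mul G.γ).sub_const (w s))
  refine ((h1.add h2).congr_deriv ?_).congr_of_eventuallyEq (Filter.Eventually.of_forall ?_)
  · simp only [id, one_mul, zero_mul, add_zero]
    rfl
  · intro t
    have h3 := G.bellmanGap_sub_value (fun s => v s + t * w s) v s (ξ t) b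
    simp only [add_sub_cancel_left] at h3
    rw [bellmanGap_eq_mixExp G v, sub_eq_iff_eq_add] at h3
    simp only [Pi.add_apply, Pi.mul_apply, id]
    rw [h3, add_comm]
    congr 1
    rw [mul_sub, Finset.mul_sum, Finset.mul_sum, Finset.mul_sum]
    congr 1
    exact Finset.sum_congr rfl fun s' _ => by
      change _ = t * (G.γ * (G.PMix s' s (ξ t) b * w s'))
      ring

/-- The direction in the cone of feasible directions at `x` that moves mass towards the pure
actions with weights `c`. -/
def direction (x : TeamStrategy S A) (c : ∀ k : Fin n, S → A k → ℝ) (s : S) : ∀ k, A k → ℝ :=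
  fun k a => c k s a - (∑ a', c k s a') * profile x s k a

/-- The direction has total mass zero, and the moved point is `(1 - t ∑ c) x + t c`, which is
nonnegative for small `t`. -/
theorem exists_strategy_add_direction (x : TeamStrategy S A) {c : ∀ k : Fin n, S → A k → ℝ}
    (hc : ∀ k s a, 0 ≤ c k s a) {t : ℝ} (ht : 0 ≤ t) (htc : ∀ k s, t * ∑ a, c k s a ≤ 1) :
    ∃ z : TeamStrategy S A, ∀ k s a, z k s a = profile x s k a + t * direction x c s k a := by
  refine ⟨fun k s => ⟨fun a => profile x s k a + t * direction x c s k a, fun a => ?_, ?_⟩,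
    fun k s a => rfl⟩
  · have h1 := mul_nonneg (sub_nonneg.2 (htc k s)) (profile_nonneg x s k a)
    have h2 := mul_nonneg ht (hc k s a)
    simp only [direction]
    linarith
  · simp only [direction, Finset.sum_add_distrib, ← Finset.mul_sum, Finset.sum_sub_distrib,
      sum_profile]
    ring

open Classical in
/-- The first-order change of the squared distance to `x₀` at `x` when moving towards the pure
action `a` of player `k` in state `s`. -/
def proxSlope (x x₀ : TeamStrategy S A) (k : Fin n) (s : S) (a : A k) : ℝ :=
  2 * ∑ a', (x k s a' - x₀ k s a') * ((Pi.single a 1 : A k → ℝ) a' - x k s a')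

theorem sum_mul_direction (x x₀ : TeamStrategy S A) (c : ∀ k : Fin n, S → A k → ℝ) (k : Fin n)
    (s : S) :
    ∑ a, 2 * (x k s a - x₀ k s a) * direction x c s k a = ∑ a, c k s a * proxSlope x x₀ k s a := by
  classical
  have h : ∀ a, proxSlope x x₀ k s a
      = 2 * (x k s a - x₀ k s a) - 2 * ∑ a', (x k s a' - x₀ k s a') * x k s a' := fun a => by
    simp only [proxSlope, mul_sub (x k s _ - x₀ k s _), Finset.sum_sub_distrib]
    simp [Pi.single_apply]
    ring
  simp only [h, direction, profile]
  obtain ⟨e, he⟩ : ∃ e : A k → ℝ, ∀ a, x k s a - x₀ k s a = e a := ⟨_, fun _ => rfl⟩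
  simp only [he, mul_sub, Finset.sum_sub_distrib, ← Finset.sum_mul]
  refine congrArg₂ (· - ·) (Finset.sum_congr rfl fun a _ => by ring) ?_
  · rw [Finset.mul_sum, Finset.mul_sum]
    exact Finset.sum_congr rfl fun a _ => by ring

/-- First-order optimality of a minimiser `x` of `φ + μ ‖· - x₀‖²`: along every feasible direction
the linearised optimality equation has a solution whose value is not decreasing. -/
theorem exists_linearized_value_nonneg [Nonempty B] {μ : ℝ} {x x₀ : TeamStrategy S A}
    (hmin : ∀ z, G.phi x + μ * l2dist x x₀ ^ 2 ≤ G.phi z + μ * l2dist z x₀ ^ 2)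
    {c : ∀ k : Fin n, S → A k → ℝ} (hc : ∀ k s a, 0 ≤ c k s a) {w : S → ℝ}
    (hw : ∀ s b, G.bellmanGap (G.bestValue x) s (profile x s) b = 0 →
      ∑ k, ∑ a, c k s a * G.bellmanGap (G.bestValue x) s (pureDeviation x s k a) b
        + G.γ * ∑ s', G.PMix s' s (profile x s) b * w s' ≤ w s) :
    0 ≤ ∑ s, G.ρ s * w s + μ * ∑ k, ∑ s, ∑ a, c k s a * proxSlope x x₀ k s a := by
  classical
  by_contra hneg
  rw [not_le] at hneg
  have hρ : ∑ s, G.ρ s = 1 := G.ρ.2.2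
  set q := μ * ∑ k, ∑ s, ∑ a, c k s a * proxSlope x x₀ k s a with hq
  -- The shift `η` uses half of the available decrease. It makes the linearised inequality strict,
  -- by `(1 - γ) η`, at every tight action.
  obtain ⟨η, hη0, hη⟩ : ∃ η : ℝ, 0 < η ∧ ∑ s, G.ρ s * (w s + η) + q < 0 := by
    refine ⟨-(∑ s, G.ρ s * w s + q) / 2, by linarith, ?_⟩
    simp only [mul_add, Finset.sum_add_distrib, ← Finset.sum_mul, hρ]
    linarith
  set v := G.bestValue x with hv
  let ξ : ℝ → S → ∀ k, A k → ℝ := fun t s k a => profile x s k a + t * direction x c s k a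
  have hξ : ∀ s k a, HasDerivAt (fun t => ξ t s k a) (direction x c s k a) 0 := fun s k a =>
    (((hasDerivAt_id (0 : ℝ)).mul_const _).const_add _).congr_deriv (one_mul _)
  have hξ0 : ∀ s, ξ 0 s = profile x s := fun s => by
    funext k a
    simp [ξ]
  -- the shifted values dominate the Bellman update along the direction
  have hgap : ∀ᶠ t in nhdsWithin 0 (Set.Ioi (0 : ℝ)), ∀ s b,
      G.bellmanGap (fun s => v s + t * (w s + η)) s (ξ t s) b ≤ 0 := by
    refine Filter.eventually_all.2 fun s => Filter.eventually_all.2 fun b => ?_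
    have hd := G.hasDerivAt_bellmanGap v (fun s => w s + η) s b (hξ s)
    have h0 : G.bellmanGap (fun s => v s + 0 * (w s + η)) s (ξ 0 s) b
        = G.bellmanGap v s (profile x s) b := by
      simp [hξ0]
    -- A strictly negative gap stays negative by continuity; a zero gap becomes negative because its
    -- derivative is negative.
    rcases ((G.bellmanGap_optimal x).1 s b).lt_or_eq with hlt | heq
    · rw [← hv, ← h0] at hlt
      filter_upwards [(hd.continuousAt.eventually_lt continuousAt_const hlt).filter_mono
        nhdsWithin_le_nhds] with t ht using ht.le
    · rw [← hv] at heq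
      refine (eventually_lt_of_hasDerivAt_neg hd ?_).mono fun t ht => ?_
      · have h1 : ∀ k, mixExp (Function.update (ξ 0 s) k (direction x c s k))
            (fun a => G.r s a b + G.γ * ∑ s', G.P s a b s' * v s')
            = ∑ a, c k s a * G.bellmanGap v s (pureDeviation x s k a) b := fun k => by
          rw [hξ0]
          refine (mixExp_update_direction _ _ _ _).trans (Finset.sum_congr rfl fun a _ => ?_)
          rw [← sub_zero (G.bellmanGap v s (pureDeviation x s k a) b), ← heq,
            bellmanGap_eq_mixExp, bellmanGap_eq_mixExp, sub_sub_sub_cancel_right]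
          rfl
        have h2 := hw s b heq
        have h3 : ∑ s', G.PMix s' s (ξ 0 s) b * (w s' + η)
            = ∑ s', G.PMix s' s (profile x s) b * w s' + η := by
          simp only [hξ0, mul_add, Finset.sum_add_distrib, ← Finset.sum_mul,
            G.sum_PMix s (sum_profile x s), one_mul]
        simp only [h1, h3]
        have h4 := mul_pos G.one_sub_γ_pos hη0
        linarith
      · rw [h0, heq] at ht
        exact ht.le
  -- the objective decreases along the direction
  have hobj : ∀ᶠ t in nhdsWithin 0 (Set.Ioi (0 : ℝ)),
      ∑ s, G.ρ s * (v s + t * (w s + η)) + μ * ∑ k, ∑ s, ∑ a, (ξ t s k a - x₀ k s a) ^ 2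
        < ∑ s, G.ρ s * v s + μ * ∑ k, ∑ s, ∑ a, (x k s a - x₀ k s a) ^ 2 := by
    have hd1 : HasDerivAt (fun t : ℝ => ∑ s, G.ρ s * (v s + t * (w s + η)))
        (∑ s, G.ρ s * (w s + η)) 0 := HasDerivAt.fun_sum fun s _ =>
      ((((hasDerivAt_id (0 : ℝ)).mul_const _).const_add _).congr_deriv (one_mul _)).const_mul _
    have hd2 : HasDerivAt (fun t : ℝ => μ * ∑ k, ∑ s, ∑ a, (ξ t s k a - x₀ k s a) ^ 2)
        (μ * ∑ k, ∑ s, ∑ a, 2 * (x k s a - x₀ k s a) * direction x c s k a) 0 :=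
      (HasDerivAt.fun_sum fun k _ => HasDerivAt.fun_sum fun s _ => HasDerivAt.fun_sum fun a _ =>
        (((hξ s k a).sub_const (x₀ k s a)).pow 2).congr_deriv (by
          simp [hξ0, profile])).const_mul μ
    simp only [sum_mul_direction] at hd2
    refine (eventually_lt_of_hasDerivAt_neg (hd1.add hd2) hη).mono fun t ht => ?_
    refine lt_of_lt_of_eq ht ?_
    simp [hξ0, profile]
  have hsimplex : ∀ᶠ t in nhdsWithin 0 (Set.Ioi (0 : ℝ)), ∀ (k : Fin n) (s : S),
      t * ∑ a, c k s a ≤ 1 := by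
    refine Filter.eventually_all.2 fun k => Filter.eventually_all.2 fun s => ?_
    have hcont : ContinuousAt (fun t : ℝ => t * ∑ a, c k s a) 0 := by fun_prop
    filter_upwards [(hcont.eventually_lt continuousAt_const
      (by simp : (0 : ℝ) * ∑ a, c k s a < 1)).filter_mono nhdsWithin_le_nhds] with t ht using ht.le
  obtain ⟨t, ht, ⟨h1, h2⟩, h3⟩ :=
    (eventually_mem_nhdsWithin.and ((hgap.and hobj).and hsimplex)).exists
  obtain ⟨z, hz⟩ := exists_strategy_add_direction x hc (le_of_lt ht) h3
  have hzξ : ∀ s, profile z s = ξ t s := fun s => by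
    funext k a
    exact hz k s a
  have h4 : G.phi z ≤ ∑ s, G.ρ s * (v s + t * (w s + η)) := by
    rw [phi_eq]
    refine Finset.sum_le_sum fun s _ => mul_le_mul_of_nonneg_left ?_ (G.ρ_pos s).le
    refine G.bestValue_le_of_bellmanGap_nonpos (v := fun s => v s + t * (w s + η))
      (fun s b => ?_) s
    rw [hzξ]
    exact h1 s b
  have h5 := hmin z
  simp only [sq_l2dist, hz] at h5
  rw [phi_eq] at h5
  linarith

/-- A minimiser of `φ + μ ‖· - x₀‖²` has nonnegative Lagrange multipliers for the optimality
equations of the adversary. -/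
theorem exists_multipliers [Nonempty B] {μ : ℝ} {x x₀ : TeamStrategy S A}
    (hmin : ∀ z, G.phi x + μ * l2dist x x₀ ^ 2 ≤ G.phi z + μ * l2dist z x₀ ^ 2) :
    ∃ lam : S → B → ℝ, (∀ s b, 0 ≤ lam s b) ∧
      (∀ s b, lam s b * G.bellmanGap (G.bestValue x) s (profile x s) b = 0) ∧
      (∀ s, G.ρ s ≤ ∑ b, lam s b) ∧ (∀ s, ∑ b, lam s b ≤ 1 / (1 - G.γ)) ∧
      ∀ (k : Fin n) (s : S) (a : A k),
        0 ≤ ∑ b, lam s b * G.bellmanGap (G.bestValue x) s (pureDeviation x s k a) b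
          + μ * proxSlope x x₀ k s a := by
  classical
  set v := G.bestValue x with hv
  -- The deterministic best responses: strategies that use only tight actions.
  let Y := {y : S → B // ∀ s, G.bellmanGap v s (profile x s) (y s) = 0}
  -- The entry is player `k`'s advantage of `a` in state `s` against `y`, weighted by visitation,
  -- plus the derivative of the proximal term.
  let z : Y → (Σ k : Fin n, S × A k) → ℝ := fun y i =>
    G.visitation x (pureAdv y.1) i.2.1
      * G.bellmanGap v i.2.1 (pureDeviation x i.2.1 i.1 i.2.2) (y.1 i.2.1)
      + μ * proxSlope x x₀ i.1 i.2.1 i.2.2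
  rcases exists_simplex_nonneg_or_exists_neg z with ⟨p, hp⟩ | ⟨c, hc, hneg⟩
  · have hp0 : ∀ y, 0 ≤ p y := p.2.1
    have hp1 : ∑ y, p y = 1 := p.2.2
    -- The mixture of the occupancy measures of the strategies in `Y`.
    let lam : S → B → ℝ := fun s b =>
      ∑ y : Y, p y * (G.visitation x (pureAdv y.1) s * pureAdv y.1 s b)
    have hlam : ∀ s (g : B → ℝ), ∑ b, lam s b * g b
        = ∑ y : Y, p y * (G.visitation x (pureAdv y.1) s * g (y.1 s)) := fun s g => by
      simp only [lam, Finset.sum_mul]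
      rw [Finset.sum_comm]
      refine Finset.sum_congr rfl fun y _ => ?_
      rw [← sum_pureAdv_mul y.1 s g, Finset.mul_sum, Finset.mul_sum]
      exact Finset.sum_congr rfl fun b _ => by ring
    have hlam1 : ∀ s, ∑ b, lam s b = ∑ y : Y, p y * G.visitation x (pureAdv y.1) s := fun s => by
      simpa using hlam s fun _ => 1
    refine ⟨lam, fun s b => ?_, fun s b => ?_, fun s => ?_, fun s => ?_, fun k s a => ?_⟩
    · exact Finset.sum_nonneg fun y _ => mul_nonneg (hp0 y)
        (mul_nonneg (G.visitation_nonneg _ _ _) ((pureAdv y.1 s).2.1 b))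
    · simp only [lam, Finset.sum_mul]
      refine Finset.sum_eq_zero fun y _ => ?_
      rcases eq_or_ne b (y.1 s) with rfl | hb
      · rw [y.2 s, mul_zero]
      · rw [pureAdv_apply_of_ne y.1 hb]
        ring
    · rw [hlam1, ← one_mul (G.ρ s), ← hp1, Finset.sum_mul]
      exact Finset.sum_le_sum fun y _ =>
        mul_le_mul_of_nonneg_left (G.ρ_le_visitation _ _ s) (hp0 y)
    · rw [hlam1]
      refine (Finset.sum_le_sum fun y _ =>
        mul_le_mul_of_nonneg_left (G.visitation_le x (pureAdv y.1) s) (hp0 y)).trans_eq ?_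
      rw [← Finset.sum_mul, hp1, one_mul]
    · refine (hp ⟨k, s, a⟩).trans_eq ?_
      simp only [z, mul_add, Finset.sum_add_distrib, ← Finset.sum_mul, hp1, one_mul]
      rw [hlam s]
  · exfalso
    let c' : ∀ k : Fin n, S → A k → ℝ := fun k s a => c ⟨k, s, a⟩
    obtain ⟨y₀, hy₀, -⟩ := (G.bellmanGap_optimal x).2
    -- Decision process with tight actions only and with the weighted advantages as reward. Its
    -- greedy strategy belongs to `Y`, so the negative inequality of the alternative applies to it.
    obtain ⟨w, y, hy, hw⟩ := exists_optimality_equation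
      (fun s : S => Finset.univ.filter fun b => G.bellmanGap v s (profile x s) b = 0)
      (fun s => ⟨y₀ s, by simpa using hy₀ s⟩)
      (fun s b => ∑ k, ∑ a, c' k s a * G.bellmanGap v s (pureDeviation x s k a) b)
      (fun s b s' => G.PMix s' s (profile x s) b)
      (fun s b s' => G.PMix_nonneg s' s (profile_nonneg x s) b)
      (fun s b => G.sum_PMix s (sum_profile x s) b) G.γ_nonneg G.γ_lt_one
    have h1 := G.exists_linearized_value_nonneg hmin (c := c') (fun k s a => hc _) (w := w)
      fun s b hb => hw s b (by simpa using hb)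
    have h2 := hneg ⟨y, fun s => by simpa using (hy s).1⟩
    have h3 := G.sum_visitation_mul x (pureAdv y) w
    -- The optimality equation along `y`. Paired with the visitation measure it identifies `∑ s, ρ s
    -- * w s` with the visitation-weighted advantages, so `h1` and `h2` speak of the same number.
    have h4 : ∀ s, w s - G.γ * ∑ s', G.transMat x (pureAdv y) s s' * w s'
        = ∑ k, ∑ a, c' k s a * G.bellmanGap v s (pureDeviation x s k a) (y s) := fun s => by
      simp only [transMat, sum_pureAdv_mul]
      rw [sub_eq_iff_eq_add]
      exact (hy s).2
    simp only [h4] at h3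
    rw [← h3] at h1
    refine absurd (h1.trans_lt (lt_of_eq_of_lt ?_ h2)) (lt_irrefl _)
    rw [Fintype.sum_sigma]
    simp only [Fintype.sum_prod_type, z, mul_add, Finset.sum_add_distrib, Finset.mul_sum]
    congr 1
    · rw [Finset.sum_comm]
      exact Finset.sum_congr rfl fun k _ => Finset.sum_congr rfl fun s _ =>
        Finset.sum_congr rfl fun a _ => by simp only [c']; ring
    · exact Finset.sum_congr rfl fun k _ => Finset.sum_congr rfl fun s _ =>
        Finset.sum_congr rfl fun a _ => by simp only [c']; ring

/-! ### Feasibility of the linear program -/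

theorem abs_sub_le_l2dist (x x' : TeamStrategy S A) (k : Fin n) (s : S) (a : A k) :
    |x k s a - x' k s a| ≤ l2dist x x' := by
  refine abs_le_of_sq_le_sq ?_ (l2dist_nonneg x x')
  rw [sq_l2dist]
  have h0 : ∀ k s a, 0 ≤ (x k s a - x' k s a) ^ 2 := fun k s a => sq_nonneg _
  refine (Finset.single_le_sum (f := fun a => (x k s a - x' k s a) ^ 2)
    (fun a _ => h0 k s a) (Finset.mem_univ a)).trans ?_
  refine (Finset.single_le_sum (f := fun s => ∑ a, (x k s a - x' k s a) ^ 2)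
    (fun s _ => Finset.sum_nonneg fun a _ => h0 k s a) (Finset.mem_univ s)).trans ?_
  exact Finset.single_le_sum (f := fun k => ∑ s, ∑ a, (x k s a - x' k s a) ^ 2)
    (fun k _ => Finset.sum_nonneg fun s _ => Finset.sum_nonneg fun a _ => h0 k s a)
    (Finset.mem_univ k)

/-- Each coordinate of `x - x₀` is at most the distance and `e_a - x` has `ℓ¹` norm at most `2`; the
square contributes another `2`. -/
theorem proxSlope_le (x x₀ : TeamStrategy S A) (k : Fin n) (s : S) (a : A k) :
    proxSlope x x₀ k s a ≤ 4 * l2dist x x₀ := by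
  classical
  have h1 : ∑ a', x k s a' = 1 := (x k s).2.2
  have h2 : ∑ a', (x k s a' - x₀ k s a') * ((Pi.single a 1 : A k → ℝ) a' - x k s a')
      ≤ ∑ a', l2dist x x₀ * ((Pi.single a 1 : A k → ℝ) a' + x k s a') := by
    refine Finset.sum_le_sum fun a' _ => (le_abs_self _).trans ?_
    rw [abs_mul]
    refine mul_le_mul (abs_sub_le_l2dist x x₀ k s a') ?_ (abs_nonneg _) (l2dist_nonneg _ _)
    have h3 : 0 ≤ (Pi.single a 1 : A k → ℝ) a' := by
      by_cases h : a' = a <;> simp [h]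
    exact (abs_sub _ _).trans_eq
      (congrArg₂ (· + ·) (abs_of_nonneg h3) (abs_of_nonneg ((x k s).2.1 a')))
  rw [← Finset.mul_sum, Finset.sum_add_distrib, h1, Finset.sum_pi_single'] at h2
  simp only [Finset.mem_univ, if_true] at h2
  simp only [proxSlope]
  linarith

theorem ell_pos [Nonempty B] : 0 < G.ell := by
  have h1 := G.one_sub_γ_pos
  have h2 := G.sumA_nonneg
  have h3 : 0 < G.numB := Nat.cast_pos.2 (Fintype.card_pos (α := B))
  rw [ell]
  positivity

/-- The exact multipliers at the proximal point are used unchanged at `xhat`. Their mass is at most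
`1 / (1 - γ)`, which cancels the `1 - γ` in the perturbation bound `(1 - γ) c₂ ε` of the gaps. -/
theorem exists_LPadvFeasible [Nonempty B] {ε : ℝ} {xhat : TeamStrategy S A}
    (hx : IsNearlyStationary G.phi (1 / (2 * G.ell)) ε xhat) :
    ∃ lam : S → B → ℝ, G.LPadvFeasible xhat ε lam := by
  obtain ⟨xt, hprox, hdist⟩ := hx
  have hl := G.ell_pos
  have hg := G.one_sub_γ_pos
  have hmin : ∀ z, G.phi xt + G.ell * l2dist xt xhat ^ 2 ≤ G.phi z + G.ell * l2dist z xhat ^ 2 :=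
    fun z => by
      have h1 := mul_le_mul_of_nonneg_left (hprox z) (mul_pos two_pos hl).le
      have h2 : ∀ p d : ℝ, 2 * G.ell * (1 / (2 * G.ell) * p + d / 2) = p + G.ell * d :=
        fun p d => by field_simp
      rwa [h2, h2] at h1
  obtain ⟨lam, h0, hcs, hρ, hsum, hstat⟩ := G.exists_multipliers hmin
  have hc : 0 ≤ G.c₂ * ε := mul_nonneg G.c₂_nonneg ((l2dist_nonneg _ _).trans hdist)
  have hslack : ∀ s b, |lam s b * G.bellmanGap (G.bestValue xhat) s (profile xhat s) b|
      ≤ G.c₂ * ε := fun s b => by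
    have h1 := G.abs_bellmanGap_bestValue_sub_le xhat xt hdist s (profile_nonneg xhat s)
      (sum_profile xhat s) (profile_nonneg xt s) (sum_profile xt s) le_rfl b
    have h2 : lam s b * G.bellmanGap (G.bestValue xhat) s (profile xhat s) b
        = lam s b * (G.bellmanGap (G.bestValue xhat) s (profile xhat s) b
          - G.bellmanGap (G.bestValue xt) s (profile xt s) b) := by
      rw [mul_sub, hcs, sub_zero]
    have h3 : lam s b ≤ 1 / (1 - G.γ) :=
      (Finset.single_le_sum (fun b _ => h0 s b) (Finset.mem_univ b)).trans (hsum s)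
    rw [h2, abs_mul, abs_of_nonneg (h0 s b)]
    refine (mul_le_mul h3 h1 (abs_nonneg _) (one_div_nonneg.2 hg.le)).trans_eq ?_
    field_simp
  refine ⟨lam, h0, fun k s a => ?_, fun s b => (abs_le.1 (hslack s b)).2,
    fun s b => (abs_le.1 (hslack s b)).1, hρ, hsum⟩
  have h1 : ∑ b, lam s b * G.bellmanGap (G.bestValue xt) s (pureDeviation xt s k a) b
      - (∑ b, lam s b) * ((1 - G.γ) * (G.c₂ * ε))
      ≤ ∑ b, lam s b * G.bellmanGap (G.bestValue xhat) s (pureDeviation xhat s k a) b := by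
    rw [Finset.sum_mul, ← Finset.sum_sub_distrib]
    refine Finset.sum_le_sum fun b _ => ?_
    have h2 := G.abs_bellmanGap_bestValue_sub_le xhat xt hdist s (pureDeviation_nonneg xhat s k a)
      (sum_pureDeviation xhat s k a) (pureDeviation_nonneg xt s k a) (sum_pureDeviation xt s k a)
      (sum_abs_pureDeviation_sub_le xhat xt s k a) b
    have h3 := mul_le_mul_of_nonneg_left (abs_le.1 h2).1 (h0 s b)
    linarith
  have h2 : (∑ b, lam s b) * ((1 - G.γ) * (G.c₂ * ε)) ≤ G.c₂ * ε := by
    refine (mul_le_mul_of_nonneg_right (hsum s) (mul_nonneg hg.le hc)).trans_eq ?_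
    field_simp
  have h3 := hstat k s a
  have h4 := mul_le_mul_of_nonneg_left (proxSlope_le xt xhat k s a) hl.le
  rw [l2dist_comm] at h4
  have h5 := mul_le_mul_of_nonneg_left hdist hl.le
  rw [c₁]
  linarith

/-! ### Feasible points give approximate equilibria -/

theorem mismatch_nonneg (x : TeamStrategy S A) [Nonempty B] : 0 ≤ G.mismatch := by
  have hS : 0 < Fintype.card S := Nat.cast_pos.1 (zero_lt_one.trans_le G.numS_ge_one)
  obtain ⟨s⟩ := Fintype.card_pos_iff.1 hS
  obtain ⟨b⟩ := ‹Nonempty B›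
  exact (div_nonneg (G.visitation_nonneg _ _ _) (G.ρ_pos s).le).trans
    (G.visitation_div_le_mismatch x (pureAdv fun _ => b) s)

/-- Change of measure: the error `C / ρ s` weighted by the visitation costs at most `C * D` in each
state. -/
theorem sum_visitation_mul_ge (x : TeamStrategy S A) (y : AdvStrategy S B) {e : S → ℝ} {C : ℝ}
    (hC : 0 ≤ C) (he : ∀ s, -(C / G.ρ s) ≤ e s) :
    -(C * G.numS * G.mismatch) ≤ ∑ s, G.visitation x y s * e s := by
  have h1 : -(C * G.numS * G.mismatch) = ∑ _s : S, -(C * G.mismatch) := by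
    rw [Finset.sum_const, Finset.card_univ, nsmul_eq_mul, numS]
    ring
  rw [h1]
  refine Finset.sum_le_sum fun s _ => ?_
  have h2 := mul_le_mul_of_nonneg_left (he s) (G.visitation_nonneg x y s)
  have h3 := mul_le_mul_of_nonneg_left (G.visitation_div_le_mismatch x y s) hC
  have h4 : G.visitation x y s * -(C / G.ρ s) = -(C * (G.visitation x y s / G.ρ s)) := by ring
  linarith

theorem profile_update (x : TeamStrategy S A) (k : Fin n) (xk : S → stdSimplex ℝ (A k)) (s : S) :
    profile (Function.update x k xk) s = Function.update (profile x s) k fun a => xk s a := by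
  funext j a
  rcases eq_or_ne j k with rfl | hj
  · simp [profile]
  · simp [profile, hj]

variable {G}

section Feasible

variable {x : TeamStrategy S A} {ε : ℝ} {lam : S → B → ℝ}

theorem LPadvFeasible.sum_pos (h : G.LPadvFeasible x ε lam) (s : S) : 0 < ∑ b, lam s b :=
  (G.ρ_pos s).trans_le (h.rho_le s)

/-- The strategy of the adversary obtained by normalising a feasible point. -/
def LPadvFeasible.strategy (h : G.LPadvFeasible x ε lam) : AdvStrategy S B := fun s =>
  ⟨fun b => lam s b / ∑ b', lam s b', fun b => div_nonneg (h.nonneg s b) (h.sum_pos s).le, by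
    rw [← Finset.sum_div, div_self (h.sum_pos s).ne']⟩

theorem LPadvFeasible.strategy_apply (h : G.LPadvFeasible x ε lam) (s : S) (b : B) :
    h.strategy s b = lam s b / ∑ b', lam s b' := rfl

theorem LPadvFeasible.sum_strategy_mul (h : G.LPadvFeasible x ε lam) (s : S) (g : B → ℝ) :
    ∑ b, h.strategy s b * g b = (∑ b, lam s b * g b) / ∑ b', lam s b' := by
  rw [Finset.sum_div]
  exact Finset.sum_congr rfl fun b _ => by rw [h.strategy_apply]; ring

theorem LPadvFeasible.neg_div_le (h : G.LPadvFeasible x ε lam) {C T : ℝ} (hC : 0 ≤ C) (s : S)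
    (hT : -C ≤ T) : -(C / G.ρ s) ≤ T / ∑ b, lam s b := by
  have h1 : C / ∑ b, lam s b ≤ C / G.ρ s := div_le_div_of_nonneg_left hC (G.ρ_pos s) (h.rho_le s)
  have h2 := div_le_div_of_nonneg_right hT (h.sum_pos s).le
  rw [neg_div] at h2
  linarith

/-- Performance difference at `(x, yhat)` against the best-response value. Adding the lower slack
bounds over the adversary's actions produces the factor `B`. -/
theorem LPadvFeasible.bestValue_sub_le [Nonempty B] (h : G.LPadvFeasible x ε lam) (hε : 0 ≤ ε) :
    ∑ s, G.ρ s * G.bestValue x s - G.c₂ * G.numB * G.numS * G.mismatch * ε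
      ≤ G.Vrho x h.strategy := by
  have hC : 0 ≤ G.numB * (G.c₂ * ε) :=
    mul_nonneg (Nat.cast_nonneg _) (mul_nonneg G.c₂_nonneg hε)
  have h1 := G.sum_visitation_mul_ge x h.strategy hC
    (e := fun s => ∑ b, h.strategy s b * G.bellmanGap (G.bestValue x) s (profile x s) b)
    fun s => by
      rw [h.sum_strategy_mul]
      refine h.neg_div_le hC s ?_
      refine le_of_eq_of_le ?_ (Finset.sum_le_sum fun b _ => h.le_slack s b)
      rw [Finset.sum_const, Finset.card_univ, nsmul_eq_mul, numB]
      ring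
  rw [← G.Vrho_sub_eq x h.strategy (G.bestValue x)] at h1
  linarith

/-- Same comparison after the deviation: its gap is the `xk`-average of the gaps of pure deviations,
so the team constraints average to a lower bound. -/
theorem LPadvFeasible.bestValue_le_deviation [Nonempty B] (h : G.LPadvFeasible x ε lam)
    (hε : 0 ≤ ε) (k : Fin n) (xk : S → stdSimplex ℝ (A k)) :
    ∑ s, G.ρ s * G.bestValue x s
      ≤ G.Vrho (Function.update x k xk) h.strategy + G.c₁ * G.mismatch * G.numS * ε := by
  have hC : 0 ≤ G.c₁ * ε := mul_nonneg
    (add_nonneg (mul_nonneg (by norm_num) G.ell_pos.le) G.c₂_nonneg) hε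
  have h1 := G.sum_visitation_mul_ge (Function.update x k xk) h.strategy hC
    (e := fun s => ∑ b, h.strategy s b
      * G.bellmanGap (G.bestValue x) s (profile (Function.update x k xk) s) b)
    fun s => by
      rw [h.sum_strategy_mul]
      refine h.neg_div_le hC s ?_
      have hk : ∑ a, xk s a = 1 := (xk s).2.2
      have h2 : ∑ b, lam s b
          * G.bellmanGap (G.bestValue x) s (profile (Function.update x k xk) s) b
          = ∑ a, xk s a * ∑ b, lam s b
            * G.bellmanGap (G.bestValue x) s (pureDeviation x s k a) b := by
        simp only [profile_update, bellmanGap_update_eq_sum, Finset.mul_sum]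
        rw [Finset.sum_comm]
        exact Finset.sum_congr rfl fun a _ => Finset.sum_congr rfl fun b _ => by ring
      rw [h2, ← one_mul (-(G.c₁ * ε)), ← hk, Finset.sum_mul]
      exact Finset.sum_le_sum fun a _ =>
        mul_le_mul_of_nonneg_left (h.team_stationary k s a) ((xk s).2.1 a)
  rw [← G.Vrho_sub_eq (Function.update x k xk) h.strategy (G.bestValue x)] at h1
  linarith

end Feasible

end AdvTeamGame
end

theorem mainTheorem2 {n : ℕ} {S B : Type*} {A : Fin n → Type*}
    [Fintype S] [∀ k, Fintype (A k)] [Fintype B] [Nonempty B]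
    (G : AdvTeamGame S A B) (ε : ℝ) (hε : 0 < ε) (xhat : TeamStrategy S A)
    (hx : IsNearlyStationary G.phi (1 / (2 * G.ell)) ε xhat) :
    (∃ lam : S → B → ℝ, G.LPadvFeasible xhat ε lam) ∧
    ∀ lam : S → B → ℝ, G.LPadvFeasible xhat ε lam →
      ∃ yhat : AdvStrategy S B,
        (∀ s b, yhat s b = lam s b / ∑ b', lam s b') ∧
        (∀ (k : Fin n) (xk : S → stdSimplex ℝ (A k)),
          G.Vrho xhat yhat ≤ G.Vrho (Function.update xhat k xk) yhat
            + (G.c₂ * G.numB * G.numS * G.mismatch + G.c₁ * G.mismatch * G.numS) * ε) ∧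
        (∀ y : AdvStrategy S B,
          G.Vrho xhat y - G.c₂ * G.numB * G.numS * G.mismatch * ε ≤ G.Vrho xhat yhat) ∧
        G.IsApproxNash
          ((G.c₂ * G.numB * G.numS * G.mismatch + G.c₁ * G.mismatch * G.numS) * ε)
          xhat yhat := by
  refine ⟨G.exists_LPadvFeasible hx, fun lam h => ?_⟩
  have hD := G.mismatch_nonneg xhat
  have hS : 0 ≤ G.numS := zero_le_one.trans G.numS_ge_one
  have hB : 0 ≤ G.numB := Nat.cast_nonneg _
  have hc₂ := G.c₂_nonneg
  have hc₁ : 0 ≤ G.c₁ := add_nonneg (mul_nonneg (by norm_num) G.ell_pos.le) hc₂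
  have e1 : 0 ≤ G.c₂ * G.numB * G.numS * G.mismatch * ε := by positivity
  have e2 : 0 ≤ G.c₁ * G.mismatch * G.numS * ε := by positivity
  have hteam : ∀ (k : Fin n) (xk : S → stdSimplex ℝ (A k)),
      G.Vrho xhat h.strategy ≤ G.Vrho (Function.update xhat k xk) h.strategy
        + (G.c₂ * G.numB * G.numS * G.mismatch + G.c₁ * G.mismatch * G.numS) * ε :=
    fun k xk => by
      -- Both equilibrium inequalities pass through `∑ s, ρ s * bestValue xhat s`. For the team, the
      -- `c₁` term alone suffices; the `c₂` term is surplus.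
      have h1 := G.Vrho_le_bestValue xhat h.strategy
      have h2 := h.bestValue_le_deviation hε.le k xk
      linarith
  have hadv : ∀ y : AdvStrategy S B,
      G.Vrho xhat y - G.c₂ * G.numB * G.numS * G.mismatch * ε ≤ G.Vrho xhat h.strategy :=
    fun y => by
      have h1 := G.Vrho_le_bestValue xhat y
      have h2 := h.bestValue_sub_le hε.le
      linarith
  refine ⟨h.strategy, h.strategy_apply, hteam, hadv, hteam, fun y => ?_⟩
  have h1 := hadv y
  linarith
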